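/- Let $k\ge 3$ be an integer. Then there exist infinitely many pairwise non-isomorphic finite $k$-uniform hypergraphs that are minimal asymmetric, have maximum degree exactly $2$, and have maximum codegree exactly $1$ (i.e. are linear). Here a $k$-uniform hypergraph $\mathcal G=(\mathcal V,\mathcal E)$ has as edges $k$-element subsets of $\mathcal V$; an automorphism of $\mathcal G$ is a bijection $\phi\colon\mathcal V\to\mathcal V$ such that $\phi(E)\in\mathcal E$ for every $E\in\mathcal E$. $\mathcal G$ is symmetric if it has an automorphism other than the identity, and asymmetric otherwise. For $W\subseteq\mathcal V$, the sub-hypergraph induced by $W$ has vertex set $W$ and as edges all $E\in\mathcal E$ with $E\subseteq W$. $\mathcal G$ is minimal asymmetric if it is asymmetric and every induced sub-hypergraph on at least $2$ and fewer than $|\mathcal V|$ vertices is symmetric. The degree of a vertex is the number of edges containing it, the codegree of two distinct vertices is the number of edges containing both, and the maximum degree and maximum codegree are the maxima over all vertices and over all pairs of distinct vertices, respectively. -/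

import Mathlib

namespace Hypergraph

/-- `G` is `k`-uniform: every edge has exactly `k` vertices. -/
def IsUniform {α : Type*} (G : Hypergraph α) (k : ℕ) : Prop :=
  ∀ e ∈ G.edgeSet, e.ncard = k

/-- The sub-hypergraph of `G` induced by `W` (used for `W ⊆ V(G)`): its vertex set is `W`, and its
edges are all edges of `G` contained in `W`. -/
def induce {α : Type*} (G : Hypergraph α) (W : Set α) : Hypergraph α where
  vertexSet := G.vertexSet ∩ W
  edgeSet := {e | e ∈ G.edgeSet ∧ e ⊆ W}
  subset_vertexSet_of_mem_edgeSet' := fun _ he =>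
    Set.subset_inter (G.subset_vertexSet_of_mem_edgeSet' he.1) he.2

/-- `φ` restricts to an automorphism of `G`: a bijection of the vertex set onto itself that maps
edges to edges. The values of `φ` outside the vertex set are irrelevant. -/
def IsAutomorphism {α : Type*} (G : Hypergraph α) (φ : α → α) : Prop :=
  Set.BijOn φ G.vertexSet G.vertexSet ∧ ∀ e ∈ G.edgeSet, φ '' e ∈ G.edgeSet

/-- `G` is symmetric: it has an automorphism that moves some vertex. -/
def IsSymmetric {α : Type*} (G : Hypergraph α) : Prop :=
  ∃ φ : α → α, G.IsAutomorphism φ ∧ ∃ v ∈ G.vertexSet, φ v ≠ v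

/-- `G` is asymmetric: it is not symmetric. -/
def IsAsymmetric {α : Type*} (G : Hypergraph α) : Prop :=
  ¬ G.IsSymmetric

/-- `G` is minimal asymmetric: it is asymmetric, and every induced sub-hypergraph on at least two
and fewer than all vertices is symmetric. (For hypergraphs with finitely many vertices.) -/
def IsMinimalAsymmetric {α : Type*} (G : Hypergraph α) : Prop :=
  G.IsAsymmetric ∧
    ∀ W ⊆ G.vertexSet, 2 ≤ W.ncard → W.ncard < G.vertexSet.ncard → (G.induce W).IsSymmetric

/-- The degree of `v`: the number of edges containing `v`. -/
noncomputable def degree {α : Type*} (G : Hypergraph α) (v : α) : ℕ :=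
  {e | e ∈ G.edgeSet ∧ v ∈ e}.ncard

/-- The codegree of `u` and `v`: the number of edges containing both. -/
noncomputable def codegree {α : Type*} (G : Hypergraph α) (u v : α) : ℕ :=
  {e | e ∈ G.edgeSet ∧ u ∈ e ∧ v ∈ e}.ncard

/-- The maximum of the degrees of the vertices of `G` is `d` (and it is attained). -/
def HasMaxDegree {α : Type*} (G : Hypergraph α) (d : ℕ) : Prop :=
  IsGreatest {n | ∃ v ∈ G.vertexSet, G.degree v = n} d

/-- The maximum of the codegrees of pairs of distinct vertices of `G` is `d` (and it is
attained). -/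
def HasMaxCodegree {α : Type*} (G : Hypergraph α) (d : ℕ) : Prop :=
  IsGreatest {n | ∃ u ∈ G.vertexSet, ∃ v ∈ G.vertexSet, u ≠ v ∧ G.codegree u v = n} d

/-- `G` and `H` are isomorphic: there is a bijection between the vertex sets under which a set of
vertices is an edge of `G` if and only if its image is an edge of `H`. -/
def IsIsomorphic {α β : Type*} (G : Hypergraph α) (H : Hypergraph β) : Prop :=
  ∃ f : G.vertexSet ≃ H.vertexSet, ∀ e : Set G.vertexSet,
    (Subtype.val '' e) ∈ G.edgeSet ↔ (Subtype.val '' (f '' e)) ∈ H.edgeSet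

end Hypergraph

/-! The hypergraphs are duals of graphs. Let `r` be a finite symmetric relation in which every point
is related to exactly `k` points, a loop counting once. Links become vertices and the stars of
points become edges, so a proper link has degree two, a loop has degree one, and two stars share at
most one link. An automorphism permutes the stars, hence the points, and preserves `r`; a rigid `r`
therefore gives an asymmetric hypergraph.

For minimality, let `S` be the set of points whose whole star lies in `W`. Call a link at `x ∈ S`
private if it is a loop or leaves `S`: the star of `x` is then the only edge inside `W` containing
it. Two private links at one point can be swapped. If no point has two, an involution of `S`
preserving adjacency and moving a point extends to the links in `W`
(`isSymmetric_induce_of_involution`). So it suffices that every nonempty proper `S` with at most one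
private link per point has such an involution (`linkHypergraph_isMinimalAsymmetric`).

For `k = 3`, take a long path with a triangle glued to a square at one end and a triangle glued to a
pentagon at the other, with loops at points of degree two. The different ends make it rigid, and
omitting points frees a reflection of some cycle.

For `k = d + 1 ≥ 4`, take the bipartite circulant graph `p ~ p, …, p + d - 1` and add two links
among four points and loops at all others. Near-twins recover the cyclic order and the loopless
points remove the remaining dihedral symmetry. No nonempty proper `S` with at most one private link
per point exists at all, since loops and 4-cycles propagate membership. Varying the length or the
modulus gives infinitely many examples, told apart by their number of edges. -/

namespace Hypergraph

open Set

/-! ### Duals of graphs with loops -/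

section Link

variable {N : Type*} {r : N → N → Prop}

/-- The pairs `s(x, y)` with `y` related to `x`. -/
def star (r : N → N → Prop) (x : N) : Set (Sym2 N) := (fun y => s(x, y)) '' {y | r x y}

/-- The hypergraph whose vertices are the links `s(x, y)` of a relation `r` (loops included), with
one edge for every point `x`, formed by the links at `x`. -/
def linkHypergraph (r : N → N → Prop) : Hypergraph (Sym2 N) where
  vertexSet := ⋃ x, star r x
  edgeSet := range (star r)
  subset_vertexSet_of_mem_edgeSet' := by
    rintro _ ⟨x, rfl⟩
    exact subset_iUnion (star r) x

theorem mk_mem_star (hs : ∀ ⦃x y⦄, r x y → r y x) {x a b : N} :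
    s(a, b) ∈ star r x ↔ r a b ∧ (x = a ∨ x = b) := by
  constructor
  · rintro ⟨y, hy, h⟩
    rcases Sym2.eq_iff.1 h with ⟨rfl, rfl⟩ | ⟨rfl, rfl⟩
    · exact ⟨hy, Or.inl rfl⟩
    · exact ⟨hs hy, Or.inr rfl⟩
  · rintro ⟨h, rfl | rfl⟩
    · exact ⟨b, h, rfl⟩
    · exact ⟨a, hs h, Sym2.eq_swap⟩

theorem eq_of_mem_star_of_mem_star {x y : N} (hxy : x ≠ y) {z : Sym2 N}
    (hx : z ∈ star r x) (hy : z ∈ star r y) : z = s(x, y) ∧ r x y := by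
  obtain ⟨a, ha, rfl⟩ := hx
  obtain ⟨b, hb, h⟩ := hy
  rcases Sym2.eq_iff.1 h with ⟨h1, h2⟩ | ⟨h1, h2⟩
  · exact absurd h1.symm hxy
  · subst h1
    exact ⟨rfl, ha⟩

theorem ncard_star (r : N → N → Prop) (x : N) : (star r x).ncard = {y | r x y}.ncard :=
  ncard_image_of_injective _ fun _ _ h => Sym2.congr_right.1 h

theorem linkHypergraph_isUniform {k : ℕ} (hk : ∀ x, {y | r x y}.ncard = k) :
    (linkHypergraph r).IsUniform k := by
  rintro _ ⟨x, rfl⟩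
  rw [ncard_star, hk]

theorem star_injective {k : ℕ} (h2 : 2 ≤ k) (hk : ∀ x, {y | r x y}.ncard = k) :
    Function.Injective (star r) := by
  intro x y h
  by_contra hxy
  have hsub : star r x ⊆ {s(x, y)} := fun z hz =>
    (eq_of_mem_star_of_mem_star hxy hz (h ▸ hz)).1
  have := ncard_le_ncard hsub
  rw [ncard_star, hk, ncard_singleton] at this
  omega

theorem ncard_edgeSet_linkHypergraph {k : ℕ} (h2 : 2 ≤ k) (hk : ∀ x, {y | r x y}.ncard = k) :
    (linkHypergraph r).edgeSet.ncard = Nat.card N := by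
  change (range (star r)).ncard = _
  rw [← image_univ, ncard_image_of_injective _ (star_injective h2 hk), ncard_univ]

theorem linkHypergraph_hasMaxDegree {k : ℕ} (h2 : 2 ≤ k) (hk : ∀ x, {y | r x y}.ncard = k)
    (hs : ∀ ⦃x y⦄, r x y → r y x) (hlink : ∃ x y, x ≠ y ∧ r x y) : (linkHypergraph r).HasMaxDegree 2 := by
  have key : ∀ a b, r a b → {e | e ∈ (linkHypergraph r).edgeSet ∧ s(a, b) ∈ e}
      = star r '' {a, b} := by
    intro a b hab
    ext e
    constructor
    · rintro ⟨⟨x, rfl⟩, hx⟩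
      exact ⟨x, by simpa using ((mk_mem_star hs).1 hx).2, rfl⟩
    · rintro ⟨x, hx, rfl⟩
      exact ⟨⟨x, rfl⟩, (mk_mem_star hs).2 ⟨hab, by simpa using hx⟩⟩
  constructor
  · obtain ⟨x, y, hxy, h⟩ := hlink
    refine ⟨s(x, y), mem_iUnion.2 ⟨x, y, h, rfl⟩, ?_⟩
    rw [degree, key _ _ h, ncard_image_of_injective _ (star_injective h2 hk), ncard_pair hxy]
  · rintro _ ⟨v, hv, rfl⟩
    obtain ⟨x, y, h, rfl⟩ := mem_iUnion.1 hv
    dsimp only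
    rw [degree, key _ _ h, ncard_image_of_injective _ (star_injective h2 hk)]
    exact (ncard_insert_le _ _).trans (by simp)

theorem linkHypergraph_hasMaxCodegree {k : ℕ} (h2 : 2 ≤ k) (hk : ∀ x, {y | r x y}.ncard = k)
    [Nonempty N] : (linkHypergraph r).HasMaxCodegree 1 := by
  have key : ∀ u v : Sym2 N, u ≠ v →
      {e | e ∈ (linkHypergraph r).edgeSet ∧ u ∈ e ∧ v ∈ e}.Subsingleton := by
    rintro u v huv _ ⟨⟨x, rfl⟩, hux, hvx⟩ _ ⟨⟨y, rfl⟩, huy, hvy⟩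
    by_contra hne
    have hxy : x ≠ y := fun h => hne (by rw [h])
    exact huv ((eq_of_mem_star_of_mem_star hxy hux huy).1.trans
      (eq_of_mem_star_of_mem_star hxy hvx hvy).1.symm)
  constructor
  · obtain ⟨x⟩ := ‹Nonempty N›
    obtain ⟨u, hu, v, hv, huv⟩ := one_lt_ncard_iff_nontrivial_and_finite.1
      (show 1 < (star r x).ncard by rw [ncard_star, hk]; omega) |>.1
    refine ⟨u, mem_iUnion.2 ⟨x, hu⟩, v, mem_iUnion.2 ⟨x, hv⟩, huv, ?_⟩
    rw [codegree, ncard_eq_one]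
    exact ⟨star r x, (key u v huv).eq_singleton_of_mem ⟨⟨x, rfl⟩, hu, hv⟩⟩
  · rintro _ ⟨u, -, v, -, huv, rfl⟩
    exact (@ncard_le_one_iff_subsingleton _ _ (key u v huv).finite).2 (key u v huv)

/-- The permutation `f` of stars induced by `φ` is a permutation of points. A proper link is the
intersection of its two stars, so `φ` acts on it as `f` does on its ends. Regularity turns
preservation of `r` into equivalence. -/
theorem linkHypergraph_isAsymmetric [Finite N] {k : ℕ} (h2 : 2 ≤ k)
    (hk : ∀ x, {y | r x y}.ncard = k) (hs : ∀ ⦃x y⦄, r x y → r y x)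
    (hrigid : ∀ π : Equiv.Perm N, (∀ x y, r (π x) (π y) ↔ r x y) → π = 1) :
    (linkHypergraph r).IsAsymmetric := by
  rintro ⟨φ, ⟨hbij, hedge⟩, v, hv, hne⟩
  have hinj : ∀ {x y : N} {u w}, u ∈ star r x → w ∈ star r y → φ u = φ w → u = w :=
    fun hu hw h => hbij.injOn (mem_iUnion.2 ⟨_, hu⟩) (mem_iUnion.2 ⟨_, hw⟩) h
  choose f hf using fun x => hedge (star r x) ⟨x, rfl⟩
  have hstar : ∀ x z, z ∈ star r x → φ z ∈ star r (f x) := fun x z hz =>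
    hf x ▸ mem_image_of_mem φ hz
  have hfinj : Function.Injective f := by
    intro x y h
    apply star_injective h2 hk
    have himage : φ '' star r x = φ '' star r y := by rw [← hf, ← hf, h]
    exact (hbij.injOn.image_eq_image_iff (subset_iUnion _ x) (subset_iUnion _ y)).1 himage
  let π : Equiv.Perm N := Equiv.ofBijective f (Finite.injective_iff_bijective.1 hfinj)
  have hoff : ∀ x y, x ≠ y → r x y → φ s(x, y) = s(f x, f y) ∧ r (f x) (f y) := fun x y hxy h =>
    eq_of_mem_star_of_mem_star (hfinj.ne hxy) (hstar x _ ((mk_mem_star hs).2 ⟨h, .inl rfl⟩))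
      (hstar y _ ((mk_mem_star hs).2 ⟨h, .inr rfl⟩))
  have hloop : ∀ x, r x x → φ s(x, x) = s(f x, f x) ∧ r (f x) (f x) := by
    intro x h
    have hx := (mk_mem_star hs (x := x)).2 ⟨h, .inl rfl⟩
    obtain ⟨w, hw, hw'⟩ := hstar x _ hx
    obtain ⟨y, rfl⟩ := π.surjective w
    change s(f x, f y) = _ at hw'
    obtain rfl | hxy := eq_or_ne x y
    · exact ⟨hw'.symm, hw⟩
    -- A loop lies in one star only. If its image were a proper link, pulling back the second star
    -- would put the loop in a second star.
    · have : s(f x, f y) ∈ star r (f y) := (mk_mem_star hs).2 ⟨hw, .inr rfl⟩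
      rw [hf] at this
      obtain ⟨u, hu, hu'⟩ := this
      rw [hinj hu hx (hu'.trans hw')] at hu
      exact absurd (by simpa using ((mk_mem_star hs).1 hu).2 : y = x).symm hxy
  have hpres : ∀ x y, r x y → φ s(x, y) = s(f x, f y) ∧ r (f x) (f y) := by
    intro x y h
    obtain rfl | hxy := eq_or_ne x y
    · exact hloop x h
    · exact hoff x y hxy h
  have hπ : π = 1 := by
    refine hrigid π fun x y => ⟨fun h => ?_, fun h => (hpres x y h).2⟩
    have himage : π '' {y | r x y} = {y | r (π x) y} := by
      apply eq_of_subset_of_ncard_le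
      · rintro _ ⟨y, hy, rfl⟩
        exact (hpres x y hy).2
      · rw [ncard_image_of_injective _ π.injective, hk, hk]
      · exact toFinite _
    have : π y ∈ π '' {y | r x y} := himage ▸ h
    obtain ⟨w, hw, hwy⟩ := this
    exact π.injective hwy ▸ hw
  have hid : ∀ x, f x = x := fun x => congrArg (fun σ : Equiv.Perm N => σ x) hπ
  obtain ⟨x, y, h, rfl⟩ := mem_iUnion.1 hv
  exact hne (by simpa [hid] using (hpres x y h).1)

theorem isSymmetric_induce_of_swap {α : Type*} {G : Hypergraph α} {W : Set α}
    (hW : W ⊆ G.vertexSet) {u v : α} (hu : u ∈ W) (hv : v ∈ W) (huv : u ≠ v)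
    (h : ∀ e ∈ G.edgeSet, e ⊆ W → (u ∈ e ↔ v ∈ e)) : (G.induce W).IsSymmetric := by
  classical
  have hset : ∀ e : Set α, (u ∈ e ↔ v ∈ e) → Equiv.swap u v '' e = e := by
    intro e he
    ext w
    rw [Equiv.image_eq_preimage_symm, mem_preimage, Equiv.symm_swap]
    obtain rfl | hwu := eq_or_ne w u
    · simp [he]
    obtain rfl | hwv := eq_or_ne w v
    · simp [he]
    rw [Equiv.swap_apply_of_ne_of_ne hwu hwv]
  have huV : u ∈ (G.induce W).vertexSet := ⟨hW hu, hu⟩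
  have hvV : v ∈ (G.induce W).vertexSet := ⟨hW hv, hv⟩
  refine ⟨Equiv.swap u v, ⟨?_, fun e he => ?_⟩, u, huV, by simpa using huv.symm⟩
  · have := (Equiv.swap u v).injective.injOn.bijOn_image (s := (G.induce W).vertexSet)
    rwa [hset _ (by simp [huV, hvV])] at this
  · rwa [hset e (h e he.1 he.2)]

/-- Links inside `S` are moved by `σ`, the private link at `x` goes to the private link at `σ x`,
and links in no star of `S` stay fixed. Regularity ensures that the private links match up. -/
theorem isSymmetric_induce_of_involution [Finite N] {k : ℕ} (h2 : 2 ≤ k)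
    (hk : ∀ x, {y | r x y}.ncard = k) (hs : ∀ ⦃x y⦄, r x y → r y x) {W : Set (Sym2 N)}
    (hW : W ⊆ (linkHypergraph r).vertexSet) {S : Set N} (hS : ∀ x, x ∈ S ↔ star r x ⊆ W)
    (hpriv : ∀ x ∈ S, ∀ y y', r x y → r x y' → (y = x ∨ y ∉ S) → (y' = x ∨ y' ∉ S) → y = y')
    {σ : N → N} (hσ : Function.Involutive σ) (hσS : ∀ x ∈ S, σ x ∈ S)
    (hmove : ∃ x ∈ S, σ x ≠ x)
    (hσr : ∀ x ∈ S, ∀ y ∈ S, x ≠ y → r x y → r (σ x) (σ y)) :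
    ((linkHypergraph r).induce W).IsSymmetric := by
  classical
  let Private (x : N) (z : Sym2 N) : Prop :=
    x ∈ S ∧ ∃ y, r x y ∧ z = s(x, y) ∧ (y = x ∨ y ∉ S)
  have huniq : ∀ {x z z'}, Private x z → Private x z' → z = z' := by
    rintro x _ _ ⟨hx, y, hy, rfl, hp⟩ ⟨-, y', hy', rfl, hp'⟩
    rw [hpriv x hx y y' hy hy' hp hp']
  have hexists : ∀ {x z}, Private x z → ∃ z', Private (σ x) z' := by
    rintro x _ ⟨hx, y, hy, rfl, hp⟩
    -- Without a private link at `σ x`, its `k` neighbours lie in `S` and `σ` maps them onto all `k`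
    -- neighbours of `x`, leaving no room for the private link at `x`.
    by_contra hno
    have hinner : ∀ w, r (σ x) w → w ≠ σ x ∧ w ∈ S := by
      intro w hw
      by_contra hc
      exact hno ⟨s(σ x, w), hσS x hx, w, hw, rfl, by tauto⟩
    have hsub : σ '' {w | r (σ x) w} ⊆ {w | r x w} := by
      rintro _ ⟨w, hw, rfl⟩
      have := hσr (σ x) (hσS x hx) w (hinner w hw).2 (hinner w hw).1.symm hw
      rwa [hσ x] at this
    have heq := eq_of_subset_of_ncard_le hsub
      (by rw [ncard_image_of_injective _ hσ.injective, hk, hk])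
    have hy' : y ∈ σ '' {w | r (σ x) w} := heq ▸ hy
    obtain ⟨w, hw, rfl⟩ := hy'
    rcases hp with hp | hp
    · exact (hinner w hw).1 (by rw [← hp, hσ w])
    · exact hp (hσS w (hinner w hw).2)
  have hprivmem : ∀ {x z}, Private x z → ∀ x' ∈ S, z ∈ star r x' → x' = x := by
    rintro x _ ⟨hx, y, hy, rfl, hp⟩ x' hx' hz
    rcases ((mk_mem_star hs).1 hz).2 with rfl | rfl
    · rfl
    · exact hp.resolve_right (not_not.2 hx')
  let Inner (z : Sym2 N) : Prop := ∃ x y, x ∈ S ∧ y ∈ S ∧ x ≠ y ∧ r x y ∧ z = s(x, y)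
  have hdisj : ∀ {x z}, Private x z → ¬ Inner z := by
    rintro x z hp ⟨a, b, ha, hb, hab, hr, rfl⟩
    exact hab ((hprivmem hp a ha ((mk_mem_star hs).2 ⟨hr, .inl rfl⟩)).trans
      (hprivmem hp b hb ((mk_mem_star hs).2 ⟨hr, .inr rfl⟩)).symm)
  let φ (z : Sym2 N) : Sym2 N :=
    if Inner z then Sym2.map σ z
    else if h : ∃ w x, Private x z ∧ Private (σ x) w then h.choose else z
  have hφinner : ∀ {x y}, x ∈ S → y ∈ S → x ≠ y → r x y → φ s(x, y) = s(σ x, σ y) := by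
    intro x y hx hy hxy h
    exact if_pos ⟨x, y, hx, hy, hxy, h, rfl⟩
  have hφpriv : ∀ {x z}, Private x z → Private (σ x) (φ z) := by
    intro x z hp
    have h : ∃ w x, Private x z ∧ Private (σ x) w := by
      obtain ⟨w, hw⟩ := hexists hp
      exact ⟨w, x, hp, hw⟩
    have : φ z = h.choose := by simp only [φ]; rw [if_neg (hdisj hp), dif_pos h]
    rw [this]
    obtain ⟨x', hx', hw⟩ := h.choose_spec
    obtain ⟨y, hy, rfl, -⟩ := hx'.2
    rwa [← hprivmem hp x' hx'.1 ⟨y, hy, rfl⟩]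
  have hφrest : ∀ {z}, (∀ x ∈ S, z ∉ star r x) → φ z = z := by
    intro z hz
    simp only [φ]
    rw [if_neg, dif_neg]
    · rintro ⟨w, x, ⟨hx, y, hy, rfl, -⟩, -⟩
      exact hz x hx ⟨y, hy, rfl⟩
    · rintro ⟨x, y, hx, -, -, hy, rfl⟩
      exact hz x hx ⟨y, hy, rfl⟩
  have hcases : ∀ {x z}, x ∈ S → z ∈ star r x →
      (∃ y ∈ S, x ≠ y ∧ r x y ∧ z = s(x, y)) ∨ Private x z := by
    rintro x _ hx ⟨y, hy, rfl⟩
    by_cases h : y ∈ S ∧ x ≠ y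
    · exact .inl ⟨y, h.1, h.2, hy, rfl⟩
    · refine .inr ⟨hx, y, hy, rfl, ?_⟩
      by_cases hyS : y ∈ S
      · exact .inl (by by_contra hc; exact h ⟨hyS, Ne.symm hc⟩)
      · exact .inr hyS
  have hφstar : ∀ {x z}, x ∈ S → z ∈ star r x → φ z ∈ star r (σ x) := by
    intro x z hx hz
    rcases hcases hx hz with ⟨y, hy, hxy, h, rfl⟩ | hp
    · rw [hφinner hx hy hxy h]
      exact ⟨σ y, hσr x hx y hy hxy h, rfl⟩
    · obtain ⟨-, y, hy, h, -⟩ := hφpriv hp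
      exact ⟨y, hy, h.symm⟩
  have hφφstar : ∀ {x z}, x ∈ S → z ∈ star r x → φ (φ z) = z := by
    intro x z hx hz
    rcases hcases hx hz with ⟨y, hy, hxy, h, rfl⟩ | hp
    · rw [hφinner hx hy hxy h, hφinner (hσS x hx) (hσS y hy) (hσ.injective.ne hxy)
        (hσr x hx y hy hxy h), hσ, hσ]
    · have := hφpriv (hφpriv hp)
      rw [hσ x] at this
      exact huniq this hp
  have hφφ : ∀ z, φ (φ z) = z := by
    intro z
    by_cases h : ∃ x ∈ S, z ∈ star r x
    · obtain ⟨x, hx, hz⟩ := h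
      exact hφφstar hx hz
    · push Not at h
      rw [hφrest h, hφrest h]
  have hφW : ∀ z ∈ W, φ z ∈ W := by
    intro z hz
    by_cases h : ∃ x ∈ S, z ∈ star r x
    · obtain ⟨x, hx, hz⟩ := h
      exact (hS _).1 (hσS x hx) (hφstar hx hz)
    · push Not at h
      rwa [hφrest h]
  have himage : ∀ x ∈ S, φ '' star r x = star r (σ x) := by
    intro x hx
    apply Subset.antisymm
    · rintro _ ⟨z, hz, rfl⟩
      exact hφstar hx hz
    · intro z hz
      refine ⟨φ z, ?_, hφφ z⟩
      have := hφstar (hσS x hx) hz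
      rwa [hσ x] at this
  have hvertex : ((linkHypergraph r).induce W).vertexSet = W := inter_eq_right.2 hW
  refine ⟨φ, ⟨?_, ?_⟩, ?_⟩
  · rw [hvertex]
    exact InvOn.bijOn ⟨fun z _ => hφφ z, fun z _ => hφφ z⟩ hφW hφW
  · rintro _ ⟨⟨x, rfl⟩, hx⟩
    have hxS := (hS x).2 hx
    rw [himage x hxS]
    exact ⟨⟨σ x, rfl⟩, (hS _).1 (hσS x hxS)⟩
  · rw [hvertex]
    -- If `φ` fixed all of `W`, the stars of `x` and `σ x` would coincide for a moved `x`.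
    by_contra! hfix
    obtain ⟨x, hx, hne⟩ := hmove
    have hid : φ '' star r x = star r x :=
      (image_congr fun z hz => hfix z ((hS x).1 hx hz)).trans (image_id' _)
    exact hne (star_injective h2 hk ((himage x hx).symm.trans hid))

theorem linkHypergraph_isMinimalAsymmetric [Finite N] {k : ℕ} (h2 : 2 ≤ k)
    (hk : ∀ x, {y | r x y}.ncard = k) (hs : ∀ ⦃x y⦄, r x y → r y x)
    (hrigid : ∀ π : Equiv.Perm N, (∀ x y, r (π x) (π y) ↔ r x y) → π = 1)
    (hmin : ∀ S : Set N, S.Nonempty → S ≠ univ →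
      (∀ x ∈ S, ∀ y y', r x y → r x y' → (y = x ∨ y ∉ S) → (y' = x ∨ y' ∉ S) → y = y') →
      ∃ σ : N → N, Function.Involutive σ ∧ (∀ x ∈ S, σ x ∈ S) ∧ (∃ x ∈ S, σ x ≠ x) ∧
        ∀ x ∈ S, ∀ y ∈ S, x ≠ y → r x y → r (σ x) (σ y)) :
    (linkHypergraph r).IsMinimalAsymmetric := by
  refine ⟨linkHypergraph_isAsymmetric h2 hk hs hrigid, fun W hW hW2 hlt => ?_⟩
  let S : Set N := {x | star r x ⊆ W}
  rcases S.eq_empty_or_nonempty with hempty | hne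
  · obtain ⟨u, hu, v, hv, huv⟩ := (one_lt_ncard_iff_nontrivial_and_finite.1 hW2).1
    refine isSymmetric_induce_of_swap hW hu hv huv ?_
    rintro _ ⟨x, rfl⟩ hx
    exact absurd (show x ∈ S from hx) (hempty ▸ notMem_empty x)
  have huniv : S ≠ univ := by
    intro h
    have : (linkHypergraph r).vertexSet ⊆ W := iUnion_subset fun x =>
      show x ∈ S from h ▸ mem_univ x
    exact absurd (ncard_le_ncard this) (not_le.2 hlt)
  by_cases hpriv : ∀ x ∈ S, ∀ y y', r x y → r x y' → (y = x ∨ y ∉ S) → (y' = x ∨ y' ∉ S) → y = y'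
  · obtain ⟨σ, hσ, hσS, hmove, hσr⟩ := hmin S hne huniv hpriv
    exact isSymmetric_induce_of_involution h2 hk hs hW (fun _ => Iff.rfl) hpriv hσ hσS hmove hσr
  · push Not at hpriv
    obtain ⟨x, hx, y, y', hy, hy', hp, hp', hyy⟩ := hpriv
    have key : ∀ w, r x w → (w = x ∨ w ∉ S) → ∀ z ∈ S, s(x, w) ∈ star r z ↔ z = x := by
      intro w hw hp z hz
      rw [mk_mem_star hs]
      constructor
      · rintro ⟨-, h | rfl⟩
        · exact h
        · exact hp.resolve_right (not_not.2 hz)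
      · rintro rfl
        exact ⟨hw, .inl rfl⟩
    refine isSymmetric_induce_of_swap (u := s(x, y)) (v := s(x, y')) hW (hx ⟨y, hy, rfl⟩)
      (hx ⟨y', hy', rfl⟩) (fun h => hyy (Sym2.congr_right.1 h)) ?_
    rintro _ ⟨z, rfl⟩ hz
    rw [key y hy hp z hz, key y' hy' hp' z hz]

end Link

/-! ### The number of edges as an invariant, and the family of duals -/

theorem IsIsomorphic.ncard_edgeSet_eq {α β : Type*} {G : Hypergraph α} {H : Hypergraph β}
    (h : G.IsIsomorphic H) : G.edgeSet.ncard = H.edgeSet.ncard := by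
  obtain ⟨f, hf⟩ := h
  have hG : ∀ e ∈ G.edgeSet, ∃ e' : Set G.vertexSet, Subtype.val '' e' = e := fun e he =>
    ⟨Subtype.val ⁻¹' e, Subtype.image_preimage_val _ _ |>.trans
      (inter_eq_right.2 (G.subset_vertexSet_of_mem_edgeSet' he))⟩
  have hH : ∀ e ∈ H.edgeSet, ∃ e' : Set H.vertexSet, Subtype.val '' e' = e := fun e he =>
    ⟨Subtype.val ⁻¹' e, Subtype.image_preimage_val _ _ |>.trans
      (inter_eq_right.2 (H.subset_vertexSet_of_mem_edgeSet' he))⟩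
  refine BijOn.ncard_eq (f := fun e => Subtype.val '' (f '' (Subtype.val ⁻¹' e))) ⟨?_, ?_, ?_⟩
  · intro e he
    obtain ⟨e, rfl⟩ := hG e he
    dsimp only
    rw [preimage_image_eq _ Subtype.val_injective]
    exact (hf e).1 he
  · intro e he e' he' h
    obtain ⟨e, rfl⟩ := hG e he
    obtain ⟨e', rfl⟩ := hG e' he'
    dsimp only at h
    rw [preimage_image_eq _ Subtype.val_injective, preimage_image_eq _ Subtype.val_injective] at h
    rw [f.injective.image_injective (Subtype.val_injective.image_injective h)]
  · intro e he
    obtain ⟨e, rfl⟩ := hH e he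
    refine ⟨Subtype.val '' (f.symm '' e), (hf _).2 ?_, ?_⟩
    · rwa [Equiv.image_symm_image] 
    · dsimp only
      rw [preimage_image_eq _ Subtype.val_injective, Equiv.image_symm_image]

/-- The link hypergraphs of critical relations on sets of pairwise distinct sizes are pairwise
non-isomorphic, minimal asymmetric and linear of maximum degree two. -/
theorem exists_family_of_links {k : ℕ} (h2 : 2 ≤ k) (N : ℕ → Type) [∀ n, Finite (N n)]
    (hcard : Function.Injective fun n => Nat.card (N n)) (r : ∀ n, N n → N n → Prop)
    (hs : ∀ n ⦃x y⦄, r n x y → r n y x) (hk : ∀ n x, {y | r n x y}.ncard = k)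
    (hlink : ∀ n, ∃ x y, x ≠ y ∧ r n x y)
    (hrigid : ∀ n, ∀ π : Equiv.Perm (N n), (∀ x y, r n (π x) (π y) ↔ r n x y) → π = 1)
    (hmin : ∀ n, ∀ S : Set (N n), S.Nonempty → S ≠ univ →
      (∀ x ∈ S, ∀ y y', r n x y → r n x y' → (y = x ∨ y ∉ S) → (y' = x ∨ y' ∉ S) → y = y') →
      ∃ σ : N n → N n, Function.Involutive σ ∧ (∀ x ∈ S, σ x ∈ S) ∧ (∃ x ∈ S, σ x ≠ x) ∧
        ∀ x ∈ S, ∀ y ∈ S, x ≠ y → r n x y → r n (σ x) (σ y)) :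
    ∃ (V : ℕ → Type) (G : (n : ℕ) → Hypergraph (V n)),
      (∀ m n : ℕ, m ≠ n → ¬ (G m).IsIsomorphic (G n)) ∧
      ∀ n : ℕ,
        (G n).vertexSet.Finite ∧
        (G n).IsUniform k ∧
        (G n).IsMinimalAsymmetric ∧
        (G n).HasMaxDegree 2 ∧
        (G n).HasMaxCodegree 1 := by
  refine ⟨fun n => Sym2 (N n), fun n => linkHypergraph (r n), fun m n hmn hiso => hmn ?_,
    fun n => ⟨toFinite _, linkHypergraph_isUniform (hk n),
      linkHypergraph_isMinimalAsymmetric h2 (hk n) (hs n) (hrigid n) (hmin n),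
      linkHypergraph_hasMaxDegree h2 (hk n) (hs n) (hlink n), ?_⟩⟩
  · have := hiso.ncard_edgeSet_eq
    rw [ncard_edgeSet_linkHypergraph h2 (hk m), ncard_edgeSet_linkHypergraph h2 (hk n)] at this
    exact hcard this
  · have : Nonempty (N n) := ⟨(hlink n).choose⟩
    exact linkHypergraph_hasMaxCodegree h2 (hk n)

/-! ### The case `k = 3`: the chorded path and its rigidity -/

section ChordedPath

/-- Adjacency on `0, …, L` in the path `0, 1, …, L` with the chords `{0, 2}`, `{0, 4}`,
`{L, L - 2}`, `{L, L - 5}`: two cycles with a chord each, joined by a path. -/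
def ChordedPathAdj (L i j : ℕ) : Prop :=
  j = i + 1 ∨ i = j + 1 ∨ (i = 0 ∧ (j = 2 ∨ j = 4)) ∨ (j = 0 ∧ (i = 2 ∨ i = 4)) ∨
    (i = L ∧ (j + 2 = L ∨ j + 5 = L)) ∨ (j = L ∧ (i + 2 = L ∨ i + 5 = L))

/-- The points of degree three of the chorded path. -/
def ChordedPathBranch (L i : ℕ) : Prop :=
  i = 0 ∨ i = 2 ∨ i = 4 ∨ i = L ∨ i + 2 = L ∨ i + 5 = L

/-- The chorded path with a loop at every point of degree two. -/
def chordedPath (L : ℕ) (x y : Fin (L + 1)) : Prop :=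
  ChordedPathAdj L x y ∨ (x = y ∧ ¬ ChordedPathBranch L x)

variable {L : ℕ}

theorem chordedPath_symm ⦃x y : Fin (L + 1)⦄ (h : chordedPath L x y) : chordedPath L y x := by
  rcases h with h | ⟨rfl, h⟩
  · left
    unfold ChordedPathAdj at *
    tauto
  · exact .inr ⟨rfl, h⟩

theorem not_chordedPathAdj_self (i : ℕ) : ¬ ChordedPathAdj L i i := by
  unfold ChordedPathAdj
  omega

theorem chordedPathAdj_zero (hL : 11 ≤ L) {j : ℕ} :
    ChordedPathAdj L 0 j ↔ j = 1 ∨ j = 2 ∨ j = 4 := by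
  unfold ChordedPathAdj
  omega

theorem chordedPathAdj_two (hL : 11 ≤ L) {j : ℕ} :
    ChordedPathAdj L 2 j ↔ j = 0 ∨ j = 1 ∨ j = 3 := by
  unfold ChordedPathAdj
  omega

theorem chordedPathAdj_four (hL : 11 ≤ L) {j : ℕ} :
    ChordedPathAdj L 4 j ↔ j = 0 ∨ j = 3 ∨ j = 5 := by
  unfold ChordedPathAdj
  omega

theorem chordedPathAdj_last {j : ℕ} (hL : 11 ≤ L) (hj : j ≤ L) :
    ChordedPathAdj L L j ↔ j + 1 = L ∨ j + 2 = L ∨ j + 5 = L := by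
  unfold ChordedPathAdj
  omega

theorem chordedPathAdj_sub_two {i j : ℕ} (hL : 11 ≤ L) (hi : i + 2 = L) :
    ChordedPathAdj L i j ↔ j = L ∨ j + 1 = L ∨ j + 3 = L := by
  unfold ChordedPathAdj
  omega

theorem chordedPathAdj_sub_five {i j : ℕ} (hL : 11 ≤ L) (hi : i + 5 = L) :
    ChordedPathAdj L i j ↔ j = L ∨ j + 4 = L ∨ j + 6 = L := by
  unfold ChordedPathAdj
  omega

theorem chordedPathAdj_of_not_branch {i j : ℕ} (hi : ¬ ChordedPathBranch L i) :
    ChordedPathAdj L i j ↔ j = i + 1 ∨ i = j + 1 := by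
  unfold ChordedPathAdj ChordedPathBranch at *
  omega

theorem ncard_chordedPath (hL : 11 ≤ L) (x : Fin (L + 1)) :
    {y | chordedPath L x y}.ncard = 3 := by
  obtain ⟨i, hi⟩ := x
  have key : ∀ a b c : ℕ, a < b → b < c → c ≤ L →
      (∀ j ≤ L, (ChordedPathAdj L i j ∨ (i = j ∧ ¬ ChordedPathBranch L i)) ↔
        j = a ∨ j = b ∨ j = c) → {y | chordedPath L ⟨i, hi⟩ y}.ncard = 3 := by
    intro a b c hab hbc hc h
    rw [ncard_eq_three]
    refine ⟨⟨a, by omega⟩, ⟨b, by omega⟩, ⟨c, by omega⟩, by simp; omega, by simp; omega,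
      by simp; omega, ?_⟩
    ext y
    have := h y (by omega)
    simpa [chordedPath, Fin.ext_iff] using this
  by_cases hb : ChordedPathBranch L i
  · simp only [hb, not_true, and_false, or_false] at key
    rcases hb with rfl | rfl | rfl | rfl | hb | hb
    · exact key 1 2 4 (by omega) (by omega) (by omega) fun j _ => chordedPathAdj_zero hL
    · exact key 0 1 3 (by omega) (by omega) (by omega) fun j _ => chordedPathAdj_two hL
    · exact key 0 3 5 (by omega) (by omega) (by omega) fun j _ => chordedPathAdj_four hL
    · refine key (i - 5) (i - 2) (i - 1) (by omega) (by omega) (by omega) fun j hj => ?_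
      rw [chordedPathAdj_last hL hj]
      omega
    · refine key (L - 3) (L - 1) L (by omega) (by omega) (by omega) fun j hj => ?_
      rw [chordedPathAdj_sub_two hL hb]
      omega
    · refine key (L - 6) (L - 4) L (by omega) (by omega) (by omega) fun j hj => ?_
      rw [chordedPathAdj_sub_five hL hb]
      omega
  · have hb' := hb
    unfold ChordedPathBranch at hb'
    refine key (i - 1) i (i + 1) (by omega) (by omega) (by omega) fun j hj => ?_
    rw [chordedPathAdj_of_not_branch hb]
    simp only [hb, not_false_iff, and_true]
    omega

/-- Loops mark the points of degree two, so branch points are preserved. Only `0` and `L` have two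
branch neighbours; the square at one end and the pentagon at the other prevent their exchange. Once
the left end is fixed, each next point along the path is forced. -/
theorem chordedPath_rigid (hL : 11 ≤ L) (π : Equiv.Perm (Fin (L + 1)))
    (hπ : ∀ x y, chordedPath L (π x) (π y) ↔ chordedPath L x y) : π = 1 := by
  -- Working in `ℕ` makes the adjacency conditions accessible to `omega`; the default value `0`
  -- beyond `L` plays no role.
  obtain ⟨f, hf⟩ : ∃ f : ℕ → ℕ, ∀ x : Fin (L + 1), (π x).val = f x :=
    ⟨fun i => if h : i < L + 1 then (π ⟨i, h⟩).val else 0, fun x => by simp [x.isLt]⟩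
  have hle : ∀ i ≤ L, f i ≤ L := fun i hi => by
    have := (π ⟨i, by omega⟩).isLt
    rw [hf] at this
    exact Nat.lt_succ_iff.1 this
  have hne : ∀ i ≤ L, ∀ j ≤ L, i ≠ j → f i ≠ f j := by
    intro i hi j hj hij h
    have : π ⟨i, by omega⟩ = π ⟨j, by omega⟩ := Fin.ext (by rw [hf, hf]; exact h)
    exact hij (by simpa using π.injective this)
  have hbranch : ∀ i ≤ L, (ChordedPathBranch L (f i) ↔ ChordedPathBranch L i) := by
    intro i hi
    have := hπ ⟨i, by omega⟩ ⟨i, by omega⟩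
    simp only [chordedPath, hf, true_and, not_chordedPathAdj_self, false_or] at this
    exact not_iff_not.1 this
  have hadj : ∀ {i j : ℕ}, i ≤ L → j ≤ L → ChordedPathAdj L i j →
      ChordedPathAdj L (f i) (f j) := by
    intro i j hi hj h
    have := (hπ ⟨i, by omega⟩ ⟨j, by omega⟩).2 (Or.inl h)
    rcases this with h' | ⟨h', -⟩
    · simpa only [hf] using h'
    · have hij : i = j := by simpa using π.injective h'
      exact (not_chordedPathAdj_self j (hij ▸ h)).elim
  have hyes : ∀ i ≤ L, ChordedPathBranch L i → ChordedPathBranch L (f i) :=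
    fun i hi => (hbranch i hi).2
  have hno : ∀ i ≤ L, ¬ ChordedPathBranch L i → ¬ ChordedPathBranch L (f i) :=
    fun i hi => (not_congr (hbranch i hi)).2
  suffices hid : ∀ i ≤ L, f i = i by
    ext x
    simp only [hf, Equiv.Perm.one_apply]
    exact hid x (by omega)
  have b0 := hyes 0 (by omega) (by unfold ChordedPathBranch; omega)
  have b1 := hno 1 (by omega) (by unfold ChordedPathBranch; omega)
  have b2 := hyes 2 (by omega) (by unfold ChordedPathBranch; omega)
  have b3 := hno 3 (by omega) (by unfold ChordedPathBranch; omega)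
  have b4 := hyes 4 (by omega) (by unfold ChordedPathBranch; omega)
  have a20 := hadj (i := 0) (j := 2) (by omega) (by omega) (by unfold ChordedPathAdj; omega)
  have a40 := hadj (i := 0) (j := 4) (by omega) (by omega) (by unfold ChordedPathAdj; omega)
  have a10 := hadj (i := 0) (j := 1) (by omega) (by omega) (by unfold ChordedPathAdj; omega)
  have a21 := hadj (i := 1) (j := 2) (by omega) (by omega) (by unfold ChordedPathAdj; omega)
  have a32 := hadj (i := 2) (j := 3) (by omega) (by omega) (by unfold ChordedPathAdj; omega)
  have a43 := hadj (i := 4) (j := 3) (by omega) (by omega) (by unfold ChordedPathAdj; omega)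
  have n24 := hne 2 (by omega) 4 (by omega) (by omega)
  have n02 := hne 0 (by omega) 2 (by omega) (by omega)
  have n03 := hne 0 (by omega) 3 (by omega) (by omega)
  have n04 := hne 0 (by omega) 4 (by omega) (by omega)
  have l1 := hle 1 (by omega)
  have l2 := hle 2 (by omega)
  have l3 := hle 3 (by omega)
  have l4 := hle 4 (by omega)
  have h0 : f 0 = 0 ∨ f 0 = L := by
    have hb0 := b0
    have hb2 := b2
    have hb4 := b4
    simp only [ChordedPathBranch] at hb0 hb2 hb4
    rcases hb0 with h | h | h | h | h | h
    · exact .inl h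
    · rw [h, chordedPathAdj_two hL] at a20 a40
      omega
    · rw [h, chordedPathAdj_four hL] at a20 a40
      omega
    · exact .inr h
    · rw [chordedPathAdj_sub_two hL h] at a20 a40
      omega
    · rw [chordedPathAdj_sub_five hL h] at a20 a40
      omega
  rw [chordedPathAdj_of_not_branch b1] at a21
  have h0 : f 0 = 0 := by
    -- If `0` went to `L`, then `2` and `4` would go to `L - 2` and `L - 5`, which have no common
    -- neighbour besides `L` to receive `3`.
    refine h0.resolve_right fun h0 => ?_
    rw [h0, chordedPathAdj_last hL (by assumption)] at a10 a20 a40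
    have h1 : f 1 + 1 = L := by
      unfold ChordedPathBranch at b1
      omega
    have h2 : f 2 + 2 = L := by omega
    have h4 : f 4 + 5 = L := by
      unfold ChordedPathBranch at b4
      omega
    rw [chordedPathAdj_sub_two hL h2] at a32
    rw [chordedPathAdj_sub_five hL h4] at a43
    unfold ChordedPathBranch at b3
    omega
  rw [h0, chordedPathAdj_zero hL] at a10 a20 a40
  have h1 : f 1 = 1 := by
    unfold ChordedPathBranch at b1
    omega
  have h2 : f 2 = 2 := by omega
  have h4 : f 4 = 4 := by
    unfold ChordedPathBranch at b4
    omega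
  have h3 : f 3 = 3 := by
    rw [h2, chordedPathAdj_two hL] at a32
    have n13 := hne 1 (by omega) 3 (by omega) (by omega)
    omega
  clear a10 a20 a40 a21 a32 a43 n24 n02 n03 n04 l1 l2 l3 l4 b0 b2 b4
  have hnext : ∀ i, i + 1 ≤ L → ChordedPathAdj L i (i + 1) := fun i _ => Or.inl rfl
  have hpath : ∀ m, m + 9 ≤ L → f (m + 3) = m + 3 ∧ f (m + 4) = m + 4 := by
    intro m
    induction m with
    | zero => exact fun _ => ⟨h3, h4⟩
    | succ m ih =>
      intro hm
      obtain ⟨e3, e4⟩ := ih (by omega)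
      refine ⟨by rw [show m + 1 + 3 = m + 4 by omega, e4], ?_⟩
      have h := hadj (by omega) (by omega) (hnext (m + 4) (by omega))
      have hn := hne (m + 3) (by omega) (m + 5) (by omega) (by omega)
      have hn0 := hne 0 (by omega) (m + 5) (by omega) (by omega)
      rw [e3] at hn
      rw [h0] at hn0
      rw [show m + 1 + 4 = m + 5 by omega]
      rw [e4, show m + 4 + 1 = m + 5 by omega] at h
      unfold ChordedPathAdj at h
      omega
  have e5 : f (L - 5) = L - 5 := by
    have h := (hpath (L - 9) (by omega)).2
    rwa [show L - 9 + 4 = L - 5 by omega] at h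
  have e6 : f (L - 6) = L - 6 := by
    have h := (hpath (L - 9) (by omega)).1
    rwa [show L - 9 + 3 = L - 6 by omega] at h
  have e4 : f (L - 4) = L - 4 := by
    have h := hadj (i := L - 5) (j := L - 4) (by omega) (by omega)
      (by unfold ChordedPathAdj; omega)
    have hn := hne (L - 6) (by omega) (L - 4) (by omega) (by omega)
    have hb := hno (L - 4) (by omega) (by unfold ChordedPathBranch; omega)
    rw [e5, chordedPathAdj_sub_five hL (by omega)] at h
    unfold ChordedPathBranch at hb
    omega
  have e3 : f (L - 3) = L - 3 := by
    have h := hadj (i := L - 4) (j := L - 3) (by omega) (by omega)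
      (by unfold ChordedPathAdj; omega)
    have hn := hne (L - 5) (by omega) (L - 3) (by omega) (by omega)
    rw [e4, chordedPathAdj_of_not_branch (by unfold ChordedPathBranch; omega)] at h
    omega
  have e2 : f (L - 2) = L - 2 := by
    have h := hadj (i := L - 3) (j := L - 2) (by omega) (by omega)
      (by unfold ChordedPathAdj; omega)
    have hn := hne (L - 4) (by omega) (L - 2) (by omega) (by omega)
    rw [e3, chordedPathAdj_of_not_branch (by unfold ChordedPathBranch; omega)] at h
    omega
  have e0 : f L = L := by
    have h := hadj (i := L - 5) (j := L) (by omega) le_rfl (by unfold ChordedPathAdj; omega)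
    have hn := hne (L - 4) (by omega) L (by omega) (by omega)
    have hn' := hne (L - 6) (by omega) L (by omega) (by omega)
    rw [e5, chordedPathAdj_sub_five hL (by omega)] at h
    omega
  have e1 : f (L - 1) = L - 1 := by
    have h := hadj (i := L - 2) (j := L - 1) (by omega) (by omega)
      (by unfold ChordedPathAdj; omega)
    have hn := hne (L - 3) (by omega) (L - 1) (by omega) (by omega)
    have hn' := hne L le_rfl (L - 1) (by omega) (by omega)
    rw [e2, chordedPathAdj_sub_two hL (by omega)] at h
    omega
  intro i hi
  by_cases hlow : i ≤ 3
  · interval_cases i <;> assumption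
  by_cases hhigh : i + 5 ≤ L
  · have := (hpath (i - 4) (by omega)).2
    rwa [show i - 4 + 4 = i by omega] at this
  obtain rfl | rfl | rfl | rfl | rfl : i = L - 4 ∨ i = L - 3 ∨ i = L - 2 ∨ i = L - 1 ∨ i = L := by
    omega
  all_goals assumption

/-! ### The chorded path: involutions of proper subsets -/

theorem chordedPathAdj_symm {i j : ℕ} (h : ChordedPathAdj L i j) : ChordedPathAdj L j i := by
  unfold ChordedPathAdj at *
  tauto

/-- The map exchanging `a` with `b` and `c` with `d`. -/
def doubleSwap (a b c d i : ℕ) : ℕ :=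
  if i = a then b else if i = b then a else if i = c then d else if i = d then c else i

/-- All required involutions are one or two transpositions; a single one is encoded by `c = a`, `d =
b`. Adjacency needs checking only for pairs with a first point among the four, by symmetry and since
the other points are fixed. -/
theorem exists_involution_of_doubleSwap {S : Set (Fin (L + 1))} {P : ℕ → Prop}
    (hP : ∀ x : Fin (L + 1), x ∈ S ↔ P x) {a b c d : ℕ} (ha : a ≤ L) (hb : b ≤ L) (hc : c ≤ L)
    (hd : d ≤ L) (hab : a ≠ b)
    (hdisj : (c = a ∧ d = b) ∨ (c ≠ a ∧ c ≠ b ∧ d ≠ a ∧ d ≠ b ∧ c ≠ d))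
    (hPab : P a ↔ P b) (hPcd : P c ↔ P d) (hPa : P a)
    (hadj : ∀ i j, i = a ∨ i = b ∨ i = c ∨ i = d → j ≤ L → P i → P j → ChordedPathAdj L i j →
      ChordedPathAdj L (doubleSwap a b c d i) (doubleSwap a b c d j)) :
    ∃ σ : Fin (L + 1) → Fin (L + 1), Function.Involutive σ ∧ (∀ x ∈ S, σ x ∈ S) ∧
      (∃ x ∈ S, σ x ≠ x) ∧
      ∀ x ∈ S, ∀ y ∈ S, x ≠ y → chordedPath L x y → chordedPath L (σ x) (σ y) := by
  have hle : ∀ x : Fin (L + 1), doubleSwap a b c d x < L + 1 := by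
    intro x
    have := x.isLt
    unfold doubleSwap
    split_ifs <;> omega
  have hfix : ∀ i, ¬ (i = a ∨ i = b ∨ i = c ∨ i = d) → doubleSwap a b c d i = i := by
    intro i hi
    unfold doubleSwap
    split_ifs <;> omega
  refine ⟨fun x => ⟨doubleSwap a b c d x, hle x⟩, ?_, ?_, ?_, ?_⟩
  · intro x
    apply Fin.ext
    change doubleSwap a b c d (doubleSwap a b c d x) = x
    rcases hdisj with ⟨rfl, rfl⟩ | h
    · unfold doubleSwap
      split_ifs <;> omega
    · unfold doubleSwap
      split_ifs <;> omega
  · intro x hx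
    rw [hP] at hx ⊢
    change P (doubleSwap a b c d x)
    unfold doubleSwap
    split_ifs with h1 h2 h3 h4
    · exact hPab.1 (h1 ▸ hx)
    · exact hPab.2 (h2 ▸ hx)
    · exact hPcd.1 (h3 ▸ hx)
    · exact hPcd.2 (h4 ▸ hx)
    · exact hx
  · refine ⟨⟨a, by omega⟩, (hP _).2 hPa, fun h => hab ?_⟩
    simpa [doubleSwap] using (Fin.ext_iff.1 h).symm
  · intro x hx y hy hxy h
    rw [hP] at hx hy
    have h := h.resolve_right fun h => hxy h.1
    left
    change ChordedPathAdj L (doubleSwap a b c d x) (doubleSwap a b c d y)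
    by_cases hxm : x.val = a ∨ x.val = b ∨ x.val = c ∨ x.val = d
    · exact hadj x y hxm (by omega) hx hy h
    by_cases hym : y.val = a ∨ y.val = b ∨ y.val = c ∨ y.val = d
    · exact chordedPathAdj_symm (hadj y x hym (by omega) hy hx (chordedPathAdj_symm h))
    · rwa [hfix _ hxm, hfix _ hym]

theorem not_branch_of {i : ℕ} (h0 : i ≠ 0) (h2 : i ≠ 2) (h4 : i ≠ 4) (hl : i ≠ L)
    (hl2 : i + 2 ≠ L) (hl5 : i + 5 ≠ L) : ¬ ChordedPathBranch L i := by
  unfold ChordedPathBranch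
  tauto

/-- Every point of `P` of degree two has all its neighbours in `P`, and every other point of `P`
all but at most one. -/
structure NearlyClosed (L : ℕ) (P : ℕ → Prop) : Prop where
  low : ∀ {i : ℕ} (j : ℕ), P i → i ≤ L → j ≤ L → ¬ ChordedPathBranch L i →
    ChordedPathAdj L i j → P j
  high : ∀ {i : ℕ} (j j' : ℕ), P i → i ≤ L → j ≤ L → j' ≤ L → j ≠ j' →
    ChordedPathAdj L i j → ChordedPathAdj L i j' → P j ∨ P j'

/-- At a point of degree two the loop already uses up the one private link allowed. -/
theorem nearlyClosed_of_private {S : Set (Fin (L + 1))} {P : ℕ → Prop}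
    (hP : ∀ x : Fin (L + 1), x ∈ S ↔ P x)
    (hpriv : ∀ x ∈ S, ∀ y y', chordedPath L x y → chordedPath L x y' → (y = x ∨ y ∉ S) →
      (y' = x ∨ y' ∉ S) → y = y') : NearlyClosed L P where
  low := by
    intro i j hi hiL hjL hb h
    by_contra hj
    have hij := hpriv ⟨i, by omega⟩ ((hP _).2 hi) ⟨i, by omega⟩ ⟨j, by omega⟩ (.inr ⟨rfl, hb⟩)
      (.inl h) (.inl rfl) (.inr fun hc => hj ((hP _).1 hc))
    have hij : i = j := Fin.ext_iff.1 hij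
    exact hj (hij ▸ hi)
  high := by
    intro i j j' hi hiL hjL hjL' hjj h h'
    by_contra! hc
    exact hjj (Fin.ext_iff.1 (hpriv ⟨i, by omega⟩ ((hP _).2 hi) ⟨j, by omega⟩ ⟨j', by omega⟩
      (.inl h) (.inl h') (.inr fun hj => hc.1 ((hP _).1 hj)) (.inr fun hj => hc.2 ((hP _).1 hj))))

theorem NearlyClosed.left {P : ℕ → Prop} (h : NearlyClosed L P) (hL : 11 ≤ L) :
    (P 1 → P 0 ∧ P 2) ∧ (P 3 → P 2 ∧ P 4) ∧ (P 0 → (P 1 ∨ P 2) ∧ (P 1 ∨ P 4) ∧ (P 2 ∨ P 4)) ∧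
      (P 2 → (P 0 ∨ P 1) ∧ (P 0 ∨ P 3) ∧ (P 1 ∨ P 3)) ∧
      (P 4 → (P 0 ∨ P 3) ∧ (P 0 ∨ P 5) ∧ (P 3 ∨ P 5)) := by
  have b1 : ¬ ChordedPathBranch L 1 := by apply not_branch_of <;> omega
  have b3 : ¬ ChordedPathBranch L 3 := by apply not_branch_of <;> omega
  have a1 : ∀ {j}, j = 2 ∨ 1 = j + 1 → ChordedPathAdj L 1 j :=
    (chordedPathAdj_of_not_branch b1).2
  have a3 : ∀ {j}, j = 4 ∨ 3 = j + 1 → ChordedPathAdj L 3 j :=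
    (chordedPathAdj_of_not_branch b3).2
  have a0 : ∀ {j}, j = 1 ∨ j = 2 ∨ j = 4 → ChordedPathAdj L 0 j := (chordedPathAdj_zero hL).2
  have a2 : ∀ {j}, j = 0 ∨ j = 1 ∨ j = 3 → ChordedPathAdj L 2 j := (chordedPathAdj_two hL).2
  have a4 : ∀ {j}, j = 0 ∨ j = 3 ∨ j = 5 → ChordedPathAdj L 4 j := (chordedPathAdj_four hL).2
  refine ⟨fun p => ⟨h.low 0 p ?_ ?_ b1 (a1 ?_), h.low 2 p ?_ ?_ b1 (a1 ?_)⟩,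
    fun p => ⟨h.low 2 p ?_ ?_ b3 (a3 ?_), h.low 4 p ?_ ?_ b3 (a3 ?_)⟩,
    fun p => ⟨h.high 1 2 p ?_ ?_ ?_ ?_ (a0 ?_) (a0 ?_), h.high 1 4 p ?_ ?_ ?_ ?_ (a0 ?_) (a0 ?_),
      h.high 2 4 p ?_ ?_ ?_ ?_ (a0 ?_) (a0 ?_)⟩,
    fun p => ⟨h.high 0 1 p ?_ ?_ ?_ ?_ (a2 ?_) (a2 ?_), h.high 0 3 p ?_ ?_ ?_ ?_ (a2 ?_) (a2 ?_),
      h.high 1 3 p ?_ ?_ ?_ ?_ (a2 ?_) (a2 ?_)⟩,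
    fun p => ⟨h.high 0 3 p ?_ ?_ ?_ ?_ (a4 ?_) (a4 ?_), h.high 0 5 p ?_ ?_ ?_ ?_ (a4 ?_) (a4 ?_),
      h.high 3 5 p ?_ ?_ ?_ ?_ (a4 ?_) (a4 ?_)⟩⟩
  all_goals omega

/-- Writing `L = t + 6` avoids subtraction: the right end occupies `t + 1, …, t + 6`, and `5, …, t`
is the connecting path. -/
theorem NearlyClosed.right {P : ℕ → Prop} {t : ℕ} (h : NearlyClosed (t + 6) P) (ht : 5 ≤ t) :
    (P (t + 5) → P (t + 6) ∧ P (t + 4)) ∧ (P (t + 3) → P (t + 4) ∧ P (t + 2)) ∧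
      (P (t + 2) → P (t + 3) ∧ P (t + 1)) ∧
      (P (t + 6) → (P (t + 5) ∨ P (t + 4)) ∧ (P (t + 5) ∨ P (t + 1)) ∧ (P (t + 4) ∨ P (t + 1))) ∧
      (P (t + 4) → (P (t + 6) ∨ P (t + 5)) ∧ (P (t + 6) ∨ P (t + 3)) ∧ (P (t + 5) ∨ P (t + 3))) ∧
      (P (t + 1) → (P (t + 6) ∨ P (t + 2)) ∧ (P (t + 6) ∨ P t) ∧ (P (t + 2) ∨ P t)) := by
  have hL : 11 ≤ t + 6 := by omega
  have b5 : ¬ ChordedPathBranch (t + 6) (t + 5) := by apply not_branch_of <;> omega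
  have b3 : ¬ ChordedPathBranch (t + 6) (t + 3) := by apply not_branch_of <;> omega
  have b2 : ¬ ChordedPathBranch (t + 6) (t + 2) := by apply not_branch_of <;> omega
  have a5 := fun j => (chordedPathAdj_of_not_branch b5 (j := j)).2
  have a3 := fun j => (chordedPathAdj_of_not_branch b3 (j := j)).2
  have a2 := fun j => (chordedPathAdj_of_not_branch b2 (j := j)).2
  have a6 := fun j (hj : j ≤ t + 6) => (chordedPathAdj_last hL hj).2
  have a4 := fun j => (chordedPathAdj_sub_two (i := t + 4) (j := j) hL rfl).2
  have a1 := fun j => (chordedPathAdj_sub_five (i := t + 1) (j := j) hL rfl).2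
  refine ⟨fun p => ⟨h.low _ p ?_ ?_ b5 (a5 _ ?_), h.low _ p ?_ ?_ b5 (a5 _ ?_)⟩,
    fun p => ⟨h.low _ p ?_ ?_ b3 (a3 _ ?_), h.low _ p ?_ ?_ b3 (a3 _ ?_)⟩,
    fun p => ⟨h.low _ p ?_ ?_ b2 (a2 _ ?_), h.low _ p ?_ ?_ b2 (a2 _ ?_)⟩,
    fun p => ⟨h.high _ _ p ?_ ?_ ?_ ?_ (a6 _ ?_ ?_) (a6 _ ?_ ?_),
      h.high _ _ p ?_ ?_ ?_ ?_ (a6 _ ?_ ?_) (a6 _ ?_ ?_),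
      h.high _ _ p ?_ ?_ ?_ ?_ (a6 _ ?_ ?_) (a6 _ ?_ ?_)⟩,
    fun p => ⟨h.high _ _ p ?_ ?_ ?_ ?_ (a4 _ ?_) (a4 _ ?_),
      h.high _ _ p ?_ ?_ ?_ ?_ (a4 _ ?_) (a4 _ ?_), h.high _ _ p ?_ ?_ ?_ ?_ (a4 _ ?_) (a4 _ ?_)⟩,
    fun p => ⟨h.high _ _ p ?_ ?_ ?_ ?_ (a1 _ ?_) (a1 _ ?_),
      h.high _ _ p ?_ ?_ ?_ ?_ (a1 _ ?_) (a1 _ ?_), h.high _ _ p ?_ ?_ ?_ ?_ (a1 _ ?_) (a1 _ ?_)⟩⟩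
  all_goals omega

theorem NearlyClosed.path {P : ℕ → Prop} {t : ℕ} (h : NearlyClosed (t + 6) P) (ht : 5 ≤ t) :
    (P 5 → P 4 ∧ P (t + 1)) ∧ ∀ i, 5 ≤ i → i ≤ t → (P i ↔ P 5) := by
  have hb : ∀ i, 5 ≤ i → i ≤ t → ¬ ChordedPathBranch (t + 6) i := fun i _ _ => by
    apply not_branch_of <;> omega
  have hup : ∀ i, 5 ≤ i → i ≤ t → P i → P (i + 1) := fun i h5 hi p =>
    h.low _ p (by omega) (by omega) (hb i h5 hi) (.inl rfl)
  have hdown : ∀ i, 4 ≤ i → i + 1 ≤ t → P (i + 1) → P i := fun i h5 hi p =>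
    h.low _ p (by omega) (by omega) (hb _ (by omega) hi) (.inr (.inl rfl))
  have hall : ∀ i, 5 ≤ i → i ≤ t → (P i ↔ P 5) := by
    intro i h5
    induction i, h5 using Nat.le_induction with
    | base => exact fun _ => Iff.rfl
    | succ i h5 ih =>
      intro hi
      rw [← ih (by omega)]
      exact ⟨hdown i (by omega) hi, hup i h5 (by omega)⟩
  exact ⟨fun p => ⟨hdown 4 le_rfl ht p, hup t ht le_rfl ((hall t ht le_rfl).2 p)⟩, hall⟩

/-- The three clauses prepare the swap in the triangle `0, 1, 2`, the swap of opposite corners in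
the square `0, 2, 3, 4`, and, when the path is absent, the reflection of the left end fixing `1`. -/
theorem NearlyClosed.left_cases {P : ℕ → Prop} (h : NearlyClosed L P) (hL : 11 ≤ L) :
    (P 5 → P 4 → ¬ P 3 → P 0 ∧ P 1 ∧ P 2) ∧ (P 3 → P 0 ∧ P 2 ∧ P 4) ∧
      (¬ P 5 → (P 0 ↔ P 2) ∧ (P 3 ↔ P 4) ∧ (P 1 → P 0) ∧ (P 3 → P 0)) := by
  obtain ⟨p1, p3, p0, p2, p4⟩ := h.left hL
  clear h
  generalize P 0 = a at *
  generalize P 1 = b at *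
  generalize P 2 = c at *
  generalize P 3 = d at *
  generalize P 4 = e at *
  generalize P 5 = f at *
  by_cases a <;> by_cases b <;> by_cases c <;> by_cases d <;> by_cases e <;> by_cases f <;>
    simp_all

theorem NearlyClosed.right_cases {P : ℕ → Prop} {t : ℕ} (h : NearlyClosed (t + 6) P)
    (ht : 5 ≤ t) :
    (P (t + 1) → P t → ¬ P (t + 2) → P (t + 6) ∧ P (t + 5) ∧ P (t + 4) ∧ ¬ P (t + 3)) ∧
      (P (t + 2) → P (t + 6) ∧ P (t + 4) ∧ P (t + 3) ∧ P (t + 1)) ∧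
      (¬ P t → (P (t + 6) ↔ P (t + 4)) ∧ (P (t + 1) ↔ P (t + 3)) ∧ (P (t + 5) → P (t + 6)) ∧
        (P (t + 2) → P (t + 6)) ∧ (P (t + 1) → P (t + 6))) := by
  obtain ⟨q5, q3, q2, q6, q4, q1⟩ := h.right ht
  clear h
  generalize P (t + 6) = a at *
  generalize P (t + 5) = b at *
  generalize P (t + 4) = c at *
  generalize P (t + 3) = d at *
  generalize P (t + 2) = e at *
  generalize P (t + 1) = f at *
  generalize P t = g at *
  by_cases a <;> by_cases b <;> by_cases c <;> by_cases d <;> by_cases e <;> by_cases f <;>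
    simp_all

section Compatible

variable {P : ℕ → Prop} {t : ℕ}

theorem doubleSwap_left_triangle (hL : 11 ≤ L) (h3 : ¬ P 3) (i j : ℕ)
    (hi : i = 1 ∨ i = 2 ∨ i = 1 ∨ i = 2) (_ : j ≤ L) (_ : P i) (hj : P j)
    (h : ChordedPathAdj L i j) :
    ChordedPathAdj L (doubleSwap 1 2 1 2 i) (doubleSwap 1 2 1 2 j) := by
  obtain rfl | rfl : i = 1 ∨ i = 2 := by tauto
  · obtain rfl | rfl : j = 0 ∨ j = 2 := by
      rw [chordedPathAdj_of_not_branch (by apply not_branch_of <;> omega)] at h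
      omega
    all_goals simp [doubleSwap, ChordedPathAdj]
  · rw [chordedPathAdj_two hL] at h
    obtain rfl | rfl | rfl := h
    · simp [doubleSwap, ChordedPathAdj]
    · simp [doubleSwap, ChordedPathAdj]
    · exact absurd hj h3

theorem doubleSwap_left_square (hL : 11 ≤ L) (h1 : ¬ P 1) (i j : ℕ)
    (hi : i = 0 ∨ i = 3 ∨ i = 0 ∨ i = 3) (_ : j ≤ L) (_ : P i) (hj : P j)
    (h : ChordedPathAdj L i j) :
    ChordedPathAdj L (doubleSwap 0 3 0 3 i) (doubleSwap 0 3 0 3 j) := by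
  obtain rfl | rfl : i = 0 ∨ i = 3 := by tauto
  · rw [chordedPathAdj_zero hL] at h
    obtain rfl | rfl | rfl := h
    · exact absurd hj h1
    all_goals simp [doubleSwap, ChordedPathAdj]
  · obtain rfl | rfl : j = 2 ∨ j = 4 := by
      rw [chordedPathAdj_of_not_branch (by apply not_branch_of <;> omega)] at h
      omega
    all_goals simp [doubleSwap, ChordedPathAdj]

theorem doubleSwap_left (hL : 11 ≤ L) (h5 : ¬ P 5) (i j : ℕ)
    (hi : i = 0 ∨ i = 2 ∨ i = 3 ∨ i = 4) (_ : j ≤ L) (_ : P i) (hj : P j)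
    (h : ChordedPathAdj L i j) :
    ChordedPathAdj L (doubleSwap 0 2 3 4 i) (doubleSwap 0 2 3 4 j) := by
  obtain rfl | rfl | rfl | rfl := hi
  · rw [chordedPathAdj_zero hL] at h
    obtain rfl | rfl | rfl := h
    all_goals simp [doubleSwap, ChordedPathAdj]
  · rw [chordedPathAdj_two hL] at h
    obtain rfl | rfl | rfl := h
    all_goals simp [doubleSwap, ChordedPathAdj]
  · obtain rfl | rfl : j = 2 ∨ j = 4 := by
      rw [chordedPathAdj_of_not_branch (by apply not_branch_of <;> omega)] at h
      omega
    all_goals simp [doubleSwap, ChordedPathAdj]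
  · rw [chordedPathAdj_four hL] at h
    obtain rfl | rfl | rfl := h
    · simp [doubleSwap, ChordedPathAdj]
    · simp [doubleSwap, ChordedPathAdj]
    · exact absurd hj h5

theorem chordedPathAdj_right_cases (ht : 5 ≤ t) {i j : ℕ} (hj : j ≤ t + 6)
    (h : ChordedPathAdj (t + 6) i j) :
    (i = t + 6 → j = t + 5 ∨ j = t + 4 ∨ j = t + 1) ∧ (i = t + 5 → j = t + 6 ∨ j = t + 4) ∧
      (i = t + 4 → j = t + 6 ∨ j = t + 5 ∨ j = t + 3) ∧ (i = t + 3 → j = t + 4 ∨ j = t + 2) ∧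
      (i = t + 2 → j = t + 3 ∨ j = t + 1) ∧ (i = t + 1 → j = t + 6 ∨ j = t + 2 ∨ j = t) := by
  have hL : 11 ≤ t + 6 := by omega
  refine ⟨?_, ?_, ?_, ?_, ?_, ?_⟩ <;> rintro rfl
  · rw [chordedPathAdj_last hL hj] at h
    omega
  · rw [chordedPathAdj_of_not_branch (by apply not_branch_of <;> omega)] at h
    omega
  · rw [chordedPathAdj_sub_two hL rfl] at h
    omega
  · rw [chordedPathAdj_of_not_branch (by apply not_branch_of <;> omega)] at h
    omega
  · rw [chordedPathAdj_of_not_branch (by apply not_branch_of <;> omega)] at h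
    omega
  · rw [chordedPathAdj_sub_five hL rfl] at h
    omega

theorem doubleSwap_right_triangle (ht : 5 ≤ t) (h3 : ¬ P (t + 3)) (i j : ℕ)
    (hi : i = t + 5 ∨ i = t + 4 ∨ i = t + 5 ∨ i = t + 4) (hjt : j ≤ t + 6) (_ : P i) (hj : P j)
    (h : ChordedPathAdj (t + 6) i j) :
    ChordedPathAdj (t + 6) (doubleSwap (t + 5) (t + 4) (t + 5) (t + 4) i)
      (doubleSwap (t + 5) (t + 4) (t + 5) (t + 4) j) := by
  obtain ⟨-, h5, h4, -⟩ := chordedPathAdj_right_cases ht hjt h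
  obtain rfl | rfl : i = t + 5 ∨ i = t + 4 := by tauto
  · obtain rfl | rfl := h5 rfl
    all_goals simp [doubleSwap, ChordedPathAdj]
  · obtain rfl | rfl | rfl := h4 rfl
    · simp [doubleSwap, ChordedPathAdj]
    · simp [doubleSwap, ChordedPathAdj]
    · exact absurd hj h3

theorem doubleSwap_right_pentagon (ht : 5 ≤ t) (h5 : ¬ P (t + 5)) (i j : ℕ)
    (hi : i = t + 6 ∨ i = t + 2 ∨ i = t + 4 ∨ i = t + 3) (hjt : j ≤ t + 6) (_ : P i) (hj : P j)
    (h : ChordedPathAdj (t + 6) i j) :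
    ChordedPathAdj (t + 6) (doubleSwap (t + 6) (t + 2) (t + 4) (t + 3) i)
      (doubleSwap (t + 6) (t + 2) (t + 4) (t + 3) j) := by
  obtain ⟨h6, -, h4, h3, h2, -⟩ := chordedPathAdj_right_cases ht hjt h
  obtain rfl | rfl | rfl | rfl := hi
  · obtain rfl | rfl | rfl := h6 rfl
    · exact absurd hj h5
    all_goals simp [doubleSwap, ChordedPathAdj]
  · obtain rfl | rfl := h2 rfl
    all_goals simp [doubleSwap, ChordedPathAdj]
  · obtain rfl | rfl | rfl := h4 rfl
    · simp [doubleSwap, ChordedPathAdj]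
    · exact absurd hj h5
    · simp [doubleSwap, ChordedPathAdj]
  · obtain rfl | rfl := h3 rfl
    all_goals simp [doubleSwap, ChordedPathAdj]

theorem doubleSwap_right (ht : 5 ≤ t) (h0 : ¬ P t) (i j : ℕ)
    (hi : i = t + 6 ∨ i = t + 4 ∨ i = t + 1 ∨ i = t + 3) (hjt : j ≤ t + 6) (_ : P i) (hj : P j)
    (h : ChordedPathAdj (t + 6) i j) :
    ChordedPathAdj (t + 6) (doubleSwap (t + 6) (t + 4) (t + 1) (t + 3) i)
      (doubleSwap (t + 6) (t + 4) (t + 1) (t + 3) j) := by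
  obtain ⟨h6, -, h4, h3, -, h1⟩ := chordedPathAdj_right_cases ht hjt h
  obtain rfl | rfl | rfl | rfl := hi
  · obtain rfl | rfl | rfl := h6 rfl
    all_goals simp [doubleSwap, ChordedPathAdj]
  · obtain rfl | rfl | rfl := h4 rfl
    all_goals simp [doubleSwap, ChordedPathAdj]
  · obtain rfl | rfl | rfl := h1 rfl
    · simp [doubleSwap, ChordedPathAdj]
    · simp [doubleSwap, ChordedPathAdj]
    · exact absurd hj h0
  · obtain rfl | rfl := h3 rfl
    all_goals simp [doubleSwap, ChordedPathAdj]

end Compatible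

theorem exists_involution_chordedPath {t : ℕ} (ht : 5 ≤ t) (S : Set (Fin (t + 6 + 1)))
    (hne : S.Nonempty) (huniv : S ≠ univ)
    (hpriv : ∀ x ∈ S, ∀ y y', chordedPath (t + 6) x y → chordedPath (t + 6) x y' →
      (y = x ∨ y ∉ S) → (y' = x ∨ y' ∉ S) → y = y') :
    ∃ σ : Fin (t + 6 + 1) → Fin (t + 6 + 1), Function.Involutive σ ∧ (∀ x ∈ S, σ x ∈ S) ∧
      (∃ x ∈ S, σ x ≠ x) ∧
      ∀ x ∈ S, ∀ y ∈ S, x ≠ y → chordedPath (t + 6) x y → chordedPath (t + 6) (σ x) (σ y) := by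
  obtain ⟨P, hP⟩ : ∃ P : ℕ → Prop, ∀ x : Fin (t + 6 + 1), x ∈ S ↔ P x :=
    ⟨fun i => ∃ h : i < t + 6 + 1, (⟨i, h⟩ : Fin (t + 6 + 1)) ∈ S, fun x => by simp [x.isLt]⟩
  have hL : 11 ≤ t + 6 := by omega
  have hclosed := nearlyClosed_of_private hP hpriv
  obtain ⟨ltri, lsq, lout⟩ := hclosed.left_cases hL
  obtain ⟨rtri, rpent, rout⟩ := hclosed.right_cases ht
  obtain ⟨h5, hpath⟩ := hclosed.path ht
  have htP := hpath t ht le_rfl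
  have hrange : ∀ i ≤ t + 6, i = 0 ∨ i = 1 ∨ i = 2 ∨ i = 3 ∨ i = 4 ∨ (5 ≤ i ∧ i ≤ t) ∨
      i = t + 1 ∨ i = t + 2 ∨ i = t + 3 ∨ i = t + 4 ∨ i = t + 5 ∨ i = t + 6 := fun i hi => by
    omega
  -- The connecting path lies entirely inside or outside `S`. If inside, each end is complete or has
  -- an involution fixing its attachment point `4` or `t + 1`; both being complete would give `S =
  -- univ`. If outside, each end met by `S` contains `0` or `t + 6` and can be reflected freely.
  by_cases hP5 : P 5
  · obtain ⟨hP4, hPt1⟩ := h5 hP5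
    by_cases hP3 : P 3
    swap
    · obtain ⟨p0, p1, p2⟩ := ltri hP5 hP4 hP3
      exact exists_involution_of_doubleSwap hP (by omega) (by omega) (by omega) (by omega)
        (by omega) (.inl ⟨rfl, rfl⟩) (iff_of_true p1 p2) (iff_of_true p1 p2) p1
        (doubleSwap_left_triangle hL hP3)
    obtain ⟨p0, p2, p4⟩ := lsq hP3
    by_cases hP1 : P 1
    swap
    · exact exists_involution_of_doubleSwap hP (by omega) (by omega) (by omega) (by omega)
        (by omega) (.inl ⟨rfl, rfl⟩) (iff_of_true p0 hP3) (iff_of_true p0 hP3) p0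
        (doubleSwap_left_square hL hP1)
    by_cases g2 : P (t + 2)
    swap
    · obtain ⟨g6, g5, g4, g3⟩ := rtri hPt1 (htP.2 hP5) g2
      exact exists_involution_of_doubleSwap hP (by omega) (by omega) (by omega) (by omega)
        (by omega) (.inl ⟨rfl, rfl⟩) (iff_of_true g5 g4) (iff_of_true g5 g4) g5
        (doubleSwap_right_triangle ht g3)
    obtain ⟨g6, g4, g3, g1⟩ := rpent g2
    by_cases g5 : P (t + 5)
    swap
    · exact exists_involution_of_doubleSwap hP (by omega) (by omega) (by omega) (by omega)
        (by omega) (by omega) (iff_of_true g6 g2) (iff_of_true g4 g3) g6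
        (doubleSwap_right_pentagon ht g5)
    refine absurd (eq_univ_of_forall fun x => (hP x).2 ?_) huniv
    obtain ⟨i, hi⟩ := x
    change P i
    obtain rfl | rfl | rfl | rfl | rfl | h | rfl | rfl | rfl | rfl | rfl | rfl :=
      hrange i (by omega)
    case inr.inr.inr.inr.inr.inl => exact (hpath i h.1 h.2).2 hP5
    all_goals assumption
  · obtain ⟨l02, l34, l10, l30⟩ := lout hP5
    obtain ⟨r64, r13, r56, r26, r16⟩ := rout (mt htP.1 hP5)
    by_cases p0 : P 0
    · exact exists_involution_of_doubleSwap hP (by omega) (by omega) (by omega) (by omega)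
        (by omega) (by omega) l02 l34 p0 (doubleSwap_left hL hP5)
    by_cases p6 : P (t + 6)
    · exact exists_involution_of_doubleSwap hP (by omega) (by omega) (by omega) (by omega)
        (by omega) (by omega) r64 r13 p6 (doubleSwap_right ht (mt htP.1 hP5))
    obtain ⟨⟨i, hi⟩, hx⟩ := hne
    have hx : P i := (hP _).1 hx
    exfalso
    obtain rfl | rfl | rfl | rfl | rfl | h | rfl | rfl | rfl | rfl | rfl | rfl :=
      hrange i (by omega)
    · exact p0 hx
    · exact p0 (l10 hx)
    · exact p0 (l02.2 hx)
    · exact p0 (l30 hx)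
    · exact p0 (l30 (l34.2 hx))
    · exact hP5 ((hpath i h.1 h.2).1 hx)
    · exact p6 (r16 hx)
    · exact p6 (r26 hx)
    · exact p6 (r16 (r13.2 hx))
    · exact p6 (r64.2 hx)
    · exact p6 (r56 hx)
    · exact p6 hx

end ChordedPath

/-! ### The case `k ≥ 4`: the mated Haar graph and its rigidity -/

theorem zmod_natCast_eq_cases {n a b : ℕ} (h : (a : ZMod n) = b) (ha : a < 2 * n)
    (hb : b < 2 * n) : a = b ∨ a = b + n ∨ b = a + n := by
  have h := (ZMod.natCast_eq_natCast_iff a b n).1 h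
  obtain ⟨c, hc⟩ := h.dvd
  -- Two numbers in `[0, 2n)` differ by less than `2n`, so the quotient is `-1`, `0` or `1`.
  have h1 : c < 2 := by by_contra! hc'; nlinarith
  have h2 : -2 < c := by by_contra! hc'; nlinarith
  obtain rfl | rfl | rfl : c = -1 ∨ c = 0 ∨ c = 1 := by omega
  all_goals omega

variable {n d : ℕ}

/-- Adjacency in the bipartite graph with parts two copies of `ZMod n`, in which `p` on the left is
adjacent to `p, p + 1, …, p + d - 1` on the right. -/
def HaarAdj (d : ℕ) {n : ℕ} : ZMod n ⊕ ZMod n → ZMod n ⊕ ZMod n → Prop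
  | .inl p, .inr q => ∃ j < d, q = p + (j : ℕ)
  | .inr q, .inl p => ∃ j < d, q = p + (j : ℕ)
  | _, _ => False

/-- The involution exchanging `0` with `d` on the left, and `2 * d` on the left with `3 * d` on the
right. -/
def mate (d : ℕ) {n : ℕ} : ZMod n ⊕ ZMod n → ZMod n ⊕ ZMod n
  | .inl p => if p = (0 : ℕ) then .inl (d : ℕ) else if p = d then .inl (0 : ℕ) else
      if p = (2 * d : ℕ) then .inr (3 * d : ℕ) else .inl p
  | .inr q => if q = (3 * d : ℕ) then .inl (2 * d : ℕ) else .inr q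

/-- The bipartite graph `HaarAdj` with the pairs of mates added, a loop being added at each point
which is its own mate. -/
def matedHaar (d : ℕ) {n : ℕ} (u v : ZMod n ⊕ ZMod n) : Prop :=
  HaarAdj d u v ∨ v = mate d u

theorem haarAdj_symm ⦃u v : ZMod n ⊕ ZMod n⦄ (h : HaarAdj d u v) : HaarAdj d v u := by
  cases u <;> cases v <;> exact h

theorem not_haarAdj_self (u : ZMod n ⊕ ZMod n) : ¬ HaarAdj d u u := by
  cases u <;> exact id

theorem natCast_ne_of_lt {a b : ℕ} (ha : a < n) (hb : b < n) (hab : a ≠ b) :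
    (a : ZMod n) ≠ b := fun h => by
  have := zmod_natCast_eq_cases h (by omega) (by omega)
  omega

theorem mate_inl_zero : mate d (.inl ((0 : ℕ) : ZMod n)) = .inl (d : ZMod n) := if_pos rfl

theorem mate_inl_self (hd : 2 ≤ d) (hn : 4 * d < n) : mate d (.inl (d : ZMod n)) = .inl ((0 : ℕ) : ZMod n) := by
  have h := natCast_ne_of_lt (n := n) (a := d) (b := 0) (by omega) (by omega) (by omega)
  simp only [mate, h, if_false, if_true]

theorem mate_inl_two_mul (hd : 2 ≤ d) (hn : 4 * d < n) :
    mate d (.inl ((2 * d : ℕ) : ZMod n)) = .inr ((3 * d : ℕ) : ZMod n) := by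
  have h := natCast_ne_of_lt (n := n) (a := 2 * d) (b := 0) (by omega) (by omega) (by omega)
  have h' := natCast_ne_of_lt (n := n) (a := 2 * d) (b := d) (by omega) (by omega) (by omega)
  simp only [mate, h, h', if_false, if_true]

theorem mate_inr_three_mul :
    mate d (.inr ((3 * d : ℕ) : ZMod n)) = .inl ((2 * d : ℕ) : ZMod n) := if_pos rfl

theorem eq_of_mate_ne {u : ZMod n ⊕ ZMod n} (h : mate d u ≠ u) :
    u = .inl ((0 : ℕ) : ZMod n) ∨ u = .inl (d : ZMod n) ∨ u = .inl ((2 * d : ℕ) : ZMod n) ∨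
      u = .inr ((3 * d : ℕ) : ZMod n) := by
  rcases u with p | q
  · unfold mate at h
    dsimp only at h
    split_ifs at h with h1 h2 h3
    · exact .inl (by rw [h1])
    · exact .inr (.inl (by rw [h2]))
    · exact .inr (.inr (.inl (by rw [h3])))
    · exact absurd rfl h
  · unfold mate at h
    dsimp only at h
    split_ifs at h with h1
    · exact .inr (.inr (.inr (by rw [h1])))
    · exact absurd rfl h

theorem mate_mate (hd : 2 ≤ d) (hn : 4 * d < n) (u : ZMod n ⊕ ZMod n) :
    mate d (mate d u) = u := by
  by_cases h : mate d u = u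
  · rw [h, h]
  rcases eq_of_mate_ne h with rfl | rfl | rfl | rfl
  · rw [mate_inl_zero, mate_inl_self hd hn]
  · rw [mate_inl_self hd hn, mate_inl_zero]
  · rw [mate_inl_two_mul hd hn, mate_inr_three_mul]
  · rw [mate_inr_three_mul, mate_inl_two_mul hd hn]

theorem mate_mate_ne (hd : 2 ≤ d) (hn : 4 * d < n) {u : ZMod n ⊕ ZMod n} (h : mate d u ≠ u) :
    mate d (mate d u) ≠ mate d u := by
  rw [mate_mate hd hn]
  exact h.symm

theorem not_haarAdj_natCast (hn : 4 * d < n) {a : ℕ} (ha : a = 0 ∨ a = d ∨ a = 2 * d) :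
    ¬ HaarAdj d (.inl (a : ZMod n)) (.inr ((3 * d : ℕ) : ZMod n)) := by
  rintro ⟨j, hj, h⟩
  rw [← Nat.cast_add] at h
  have := zmod_natCast_eq_cases h (by omega) (by omega)
  omega

/-- Points which are not their own mates are pairwise nonadjacent. -/
theorem not_haarAdj_of_mate_ne (hn : 4 * d < n) {u v : ZMod n ⊕ ZMod n}
    (hu : mate d u ≠ u) (hv : mate d v ≠ v) : ¬ HaarAdj d u v := by
  intro h
  rcases eq_of_mate_ne hu with rfl | rfl | rfl | rfl <;>
    rcases eq_of_mate_ne hv with rfl | rfl | rfl | rfl <;>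
    first
    | exact h
    | exact not_haarAdj_natCast hn (.inl rfl) h
    | exact not_haarAdj_natCast hn (.inr (.inl rfl)) h
    | exact not_haarAdj_natCast hn (.inr (.inr rfl)) h

theorem not_haarAdj_mate (hd : 2 ≤ d) (hn : 4 * d < n) (u : ZMod n ⊕ ZMod n) :
    ¬ HaarAdj d u (mate d u) := by
  by_cases h : mate d u = u
  · rw [h]
    exact not_haarAdj_self u
  · exact not_haarAdj_of_mate_ne hn h (mate_mate_ne hd hn h)

theorem matedHaar_symm (hd : 2 ≤ d) (hn : 4 * d < n) ⦃u v : ZMod n ⊕ ZMod n⦄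
    (h : matedHaar d u v) : matedHaar d v u := by
  rcases h with h | rfl
  · exact .inl (haarAdj_symm h)
  · exact .inr (mate_mate hd hn u).symm

theorem ncard_haarAdj (hn : 4 * d < n) (u : ZMod n ⊕ ZMod n) :
    {v | HaarAdj d u v}.ncard = d := by
  have hinj : ∀ j ∈ Iio d, ∀ j' ∈ Iio d, (j : ZMod n) = j' → j = j' := by
    intro j hj j' hj' h
    rw [mem_Iio] at hj hj'
    by_contra hne
    exact natCast_ne_of_lt (by omega) (by omega) hne h
  rcases u with p | q
  · have : {v | HaarAdj d (.inl p) v} = (fun j : ℕ => .inr (p + j)) '' Iio d := by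
      ext v
      rcases v with v | v
      · simp [HaarAdj]
      · simp [HaarAdj, eq_comm]
    rw [this, InjOn.ncard_image fun j hj j' hj' h => hinj j hj j' hj' (by simpa using h)]
    simp [ncard_eq_toFinset_card']
  · have : {v | HaarAdj d (.inr q) v} = (fun j : ℕ => .inl (q - j)) '' Iio d := by
      ext v
      rcases v with v | v
      · simp [HaarAdj, sub_eq_iff_eq_add]
      · simp [HaarAdj]
    rw [this, InjOn.ncard_image fun j hj j' hj' h => hinj j hj j' hj' (by simpa using h)]
    simp [ncard_eq_toFinset_card']

theorem ncard_matedHaar (hd : 2 ≤ d) (hn : 4 * d < n) (u : ZMod n ⊕ ZMod n) :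
    {v | matedHaar d u v}.ncard = d + 1 := by
  have : NeZero n := ⟨by omega⟩
  have h : {v | matedHaar d u v} = insert (mate d u) {v | HaarAdj d u v} := by
    ext v
    exact or_comm
  rw [h, ncard_insert_of_notMem (s := {v | HaarAdj d u v}) (not_haarAdj_mate hd hn u) (toFinite _), ncard_haarAdj hn]

/-- At most one neighbour of `u` is not a neighbour of `v ≠ u`. -/
def NearTwin (d : ℕ) {n : ℕ} (u v : ZMod n ⊕ ZMod n) : Prop :=
  u ≠ v ∧ ∀ w w', HaarAdj d u w → ¬ HaarAdj d v w → HaarAdj d u w' → ¬ HaarAdj d v w' → w = w'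

/-- Shifting an interval by one loses only its first element. -/
theorem nearTwin_add_one (hn : 1 < n) (p : ZMod n) :
    NearTwin d (.inl p) (.inl (p + 1)) := by
  have : Fact (1 < n) := ⟨hn⟩
  refine ⟨by simp, ?_⟩
  have key : ∀ w, HaarAdj d (.inl p) w → ¬ HaarAdj d (.inl (p + 1)) w → w = .inr p := by
    rintro (w | w) h h'
    · exact h.elim
    · obtain ⟨j, hj, rfl⟩ := h
      rcases j with - | j
      · simp
      · exact absurd ⟨j, by omega, by push_cast; ring⟩ h'
  intro w w' h1 h2 h3 h4
  rw [key w h1 h2, key w' h3 h4]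

theorem NearTwin.not_inl_inr (hd : 2 ≤ d) (hn : 1 < n) {p q : ZMod n} :
    ¬ NearTwin d (.inl p) (.inr q) := by
  have : Fact (1 < n) := ⟨hn⟩
  intro h
  have := h.2 (.inr p) (.inr (p + 1)) ⟨0, by omega, by simp⟩ id ⟨1, by omega, by simp⟩ id
  simp at this

theorem NearTwin.not_inr_inl (hd : 2 ≤ d) (hn : 1 < n) {p q : ZMod n} :
    ¬ NearTwin d (.inr p) (.inl q) := by
  have : Fact (1 < n) := ⟨hn⟩
  intro h
  have := h.2 (.inl p) (.inl (p - 1)) ⟨0, by omega, by simp⟩ id ⟨1, by omega, by simp⟩ id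
  exact one_ne_zero (sub_eq_self.1 (Sum.inl.inj this).symm)

/-- A shift of an interval of length `d` by anything other than `0`, `1`, `-1` loses two elements:
the first two, or the last two when the shifted interval wraps around. -/
theorem NearTwin.eq_of_inl (hd : 2 ≤ d) (hn : 4 * d < n) {p p' : ZMod n}
    (h : NearTwin d (.inl p) (.inl p')) : p' = p + 1 ∨ p' = p - 1 := by
  have : NeZero n := ⟨by omega⟩
  obtain ⟨s, hs, rfl⟩ : ∃ s < n, p' = p + (s : ℕ) :=
    ⟨(p' - p).val, ZMod.val_lt _, by simp⟩
  have hs0 : s ≠ 0 := by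
    rintro rfl
    exact h.1 (by simp)
  have hnot : ∀ a < d, (∀ j < d, (a : ZMod n) ≠ (s + j : ℕ)) →
      ¬ HaarAdj d (.inl (p + (s : ZMod n))) (.inr (p + (a : ZMod n))) := by
    rintro a - ha ⟨j, hj, h⟩
    apply ha j hj
    push_cast
    rw [add_assoc] at h
    exact add_left_cancel h
  have hadj : ∀ a < d, HaarAdj d (.inl p) (.inr (p + (a : ZMod n))) := fun a ha => ⟨a, ha, rfl⟩
  have hcontra : ∀ a < d, ∀ b < d, a ≠ b → (∀ j < d, (a : ZMod n) ≠ (s + j : ℕ)) →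
      (∀ j < d, (b : ZMod n) ≠ (s + j : ℕ)) → False := by
    intro a ha b hb hab h1 h2
    have := h.2 _ _ (hadj a ha) (hnot a ha h1) (hadj b hb) (hnot b hb h2)
    exact natCast_ne_of_lt (n := n) (a := a) (b := b) (by omega) (by omega) hab (by simpa using this)
  by_cases h1 : s = 1
  · left
    simp [h1]
  by_cases h2 : s = n - 1
  · right
    rw [h2, Nat.cast_sub (by omega)]
    simp [sub_eq_add_neg]
  exfalso
  by_cases h3 : s + d ≤ n
  · refine hcontra 0 (by omega) 1 (by omega) (by omega) ?_ ?_ <;> intro j hj hc <;>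
      have := zmod_natCast_eq_cases hc (by omega) (by omega) <;> omega
  · refine hcontra (d - 1) (by omega) (d - 2) (by omega) (by omega) ?_ ?_ <;> intro j hj hc <;>
      have := zmod_natCast_eq_cases hc (by omega) (by omega) <;> omega

/-- Loops identify the points that are their own mates, and links between distinct loopless points
are exactly the mate pairs. Hence `π` respects mates, Haar adjacency and near-twins, so it carries
the cyclic order of the left side to that of a side. -/
theorem matedHaar_rigid (hd : 2 ≤ d) (hn : 4 * d < n) (π : Equiv.Perm (ZMod n ⊕ ZMod n))
    (hπ : ∀ u v, matedHaar d (π u) (π v) ↔ matedHaar d u v) : π = 1 := by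
  have hn1 : 1 < n := by omega
  have : NeZero n := ⟨by omega⟩
  have hloop : ∀ u, mate d (π u) = π u ↔ mate d u = u := by
    intro u
    have := hπ u u
    simp only [matedHaar, not_haarAdj_self, false_or] at this
    rw [eq_comm, this, eq_comm]
  have hmate : ∀ u, π (mate d u) = mate d (π u) := by
    intro u
    by_cases h : mate d u = u
    · rw [h, (hloop u).2 h]
    · have h1 := (hπ u (mate d u)).2 (.inr rfl)
      refine h1.resolve_left (not_haarAdj_of_mate_ne hn ?_ ?_)
      · rwa [Ne, hloop]
      · rw [Ne, hloop]
        exact mate_mate_ne hd hn h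
  have hadj : ∀ u v, HaarAdj d (π u) (π v) ↔ HaarAdj d u v := by
    have key : ∀ u v : ZMod n ⊕ ZMod n, HaarAdj d u v ↔ matedHaar d u v ∧ v ≠ mate d u := by
      intro u v
      constructor
      · intro h
        refine ⟨.inl h, ?_⟩
        rintro rfl
        exact not_haarAdj_mate hd hn u h
      · rintro ⟨h, h'⟩
        exact h.resolve_right h'
    intro u v
    rw [key, key, hπ, ← hmate, π.injective.ne_iff]
  have htwin : ∀ u v, NearTwin d u v → NearTwin d (π u) (π v) := by
    rintro u v ⟨huv, h⟩
    refine ⟨π.injective.ne huv, fun w w' h1 h2 h3 h4 => ?_⟩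
    obtain ⟨w, rfl⟩ := π.surjective w
    obtain ⟨w', rfl⟩ := π.surjective w'
    rw [hadj] at h1 h2 h3 h4
    rw [h w w' h1 h2 h3 h4]
  have hstep : ∀ p : ZMod n, NearTwin d (π (.inl p)) (π (.inl (p + 1))) := fun p =>
    htwin _ _ (nearTwin_add_one hn1 p)
  have hbranch : ∀ a : ℕ, mate d (.inl (a : ZMod n)) ≠ .inl (a : ZMod n) →
      mate d (π (.inl (a : ZMod n))) ≠ π (.inl (a : ZMod n)) := fun a h => (hloop _).not.2 h
  have b0 := hbranch 0 (by
    rw [mate_inl_zero, Ne, Sum.inl.injEq]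
    exact natCast_ne_of_lt (by omega) (by omega) (by omega))
  have b1 := hbranch d (by
    rw [mate_inl_self hd hn, Ne, Sum.inl.injEq]
    exact natCast_ne_of_lt (by omega) (by omega) (by omega))
  have b2 := hbranch (2 * d) (by
    rw [mate_inl_two_mul hd hn]
    exact Sum.inr_ne_inl)
  rcases h0 : π (.inl ((0 : ℕ) : ZMod n)) with c | c
  · obtain ⟨ε, hε, hwalk⟩ : ∃ ε : ZMod n, (ε = 1 ∨ ε = -1) ∧
        ∀ m : ℕ, π (.inl (m : ZMod n)) = .inl (c + ε * m) := by
      have h1 := hstep (0 : ℕ)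
      rcases e1 : π (.inl (((0 : ℕ) : ZMod n) + 1)) with c1 | c1
      swap
      · rw [h0, e1] at h1
        exact absurd h1 (NearTwin.not_inl_inr hd hn1)
      rw [h0, e1] at h1
      obtain ⟨ε, hε, rfl⟩ : ∃ ε : ZMod n, (ε = 1 ∨ ε = -1) ∧ c1 = c + ε := by
        rcases h1.eq_of_inl hd hn with rfl | rfl
        · exact ⟨1, .inl rfl, rfl⟩
        · exact ⟨-1, .inr rfl, sub_eq_add_neg _ _⟩
      refine ⟨ε, hε, ?_⟩
      have hpair : ∀ m : ℕ, π (.inl (m : ZMod n)) = .inl (c + ε * m) ∧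
          π (.inl ((m + 1 : ℕ) : ZMod n)) = .inl (c + ε * (m + 1 : ℕ)) := by
        intro m
        induction m with
        | zero =>
          constructor
          · rw [h0]
            simp
          · rw [Nat.cast_add, Nat.cast_one, e1]
            simp
        | succ m ih =>
          refine ⟨ih.2, ?_⟩
          have h2 := hstep ((m + 1 : ℕ) : ZMod n)
          rw [← Nat.cast_succ, ih.2] at h2
          -- Injectivity forbids turning back, so the initial direction `ε` persists.
          have hne : π (.inl ((m + 1 + 1 : ℕ) : ZMod n)) ≠ π (.inl (m : ZMod n)) := by
            intro h
            have h := Sum.inl.inj (π.injective h)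
            push_cast at h
            rw [add_assoc, add_eq_left] at h
            have h' : ((2 : ℕ) : ZMod n) = ((0 : ℕ) : ZMod n) := by
              push_cast
              rw [← h]
              norm_num
            exact natCast_ne_of_lt (by omega) (by omega) (by omega) h'
          rw [ih.1] at hne
          rcases e2 : π (.inl ((m + 1 + 1 : ℕ) : ZMod n)) with c2 | c2
          swap
          · rw [e2] at h2
            exact absurd h2 (NearTwin.not_inl_inr hd hn1)
          rw [e2] at h2 hne
          rw [Ne, Sum.inl.injEq] at hne
          rw [Sum.inl.injEq]
          rcases hε with rfl | rfl <;> rcases h2.eq_of_inl hd hn with rfl | rfl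
          · push_cast
            ring
          · exact absurd (by push_cast; ring) hne
          · exact absurd (by push_cast; ring) hne
          · push_cast
            ring
      exact fun m => (hpair m).1
    have hbranch' : ∀ p : ZMod n, mate d (.inl p) ≠ .inl p →
        p = (0 : ℕ) ∨ p = d ∨ p = (2 * d : ℕ) := fun p h => by
      simpa using eq_of_mate_ne h
    rw [h0] at b0
    rw [hwalk] at b1 b2
    have t0 := hbranch' _ b0
    have t1 := hbranch' _ b1
    have t2 := hbranch' _ b2
    -- The map `p ↦ c + ε p` must preserve the loopless left points `0, d, 2d`. As `n > 4d`, only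
    -- the identity and `p ↦ 2d - p` do so; the latter is excluded because the mate of `0` is on the
    -- left and that of `2d` on the right.
    have hc : c = 0 ∧ ε = 1 := by
      have hbad : ∀ a b : ℕ, a < n → b < n → a ≠ b → (a : ZMod n) = b → False :=
        fun a b ha hb hab h => natCast_ne_of_lt ha hb hab h
      rcases hε with rfl | rfl
      · refine ⟨?_, rfl⟩
        rcases t0 with rfl | rfl | rfl
        · simp
        · exfalso
          rcases t2 with h | h | h
          · exact hbad (3 * d) 0 (by omega) (by omega) (by omega) (by rw [← h]; push_cast; ring)
          · exact hbad (3 * d) d (by omega) (by omega) (by omega) (by rw [← h]; push_cast; ring)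
          · exact hbad (3 * d) (2 * d) (by omega) (by omega) (by omega)
              (by rw [← h]; push_cast; ring)
        · exfalso
          rcases t1 with h | h | h
          · exact hbad (3 * d) 0 (by omega) (by omega) (by omega) (by rw [← h]; push_cast; ring)
          · exact hbad (3 * d) d (by omega) (by omega) (by omega) (by rw [← h]; push_cast; ring)
          · exact hbad (3 * d) (2 * d) (by omega) (by omega) (by omega)
              (by rw [← h]; push_cast; ring)
      · exfalso
        have hneg : ∀ x : ZMod n, x + (d : ℕ) = 0 → ¬ (x = (0 : ℕ) ∨ x = d ∨ x = (2 * d : ℕ)) := by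
          rintro x hx (rfl | rfl | rfl)
          · exact hbad (0 + d) 0 (by omega) (by omega) (by omega)
              (by push_cast at hx ⊢; exact hx)
          · exact hbad (d + d) 0 (by omega) (by omega) (by omega)
              (by push_cast at hx ⊢; exact hx)
          · exact hbad (2 * d + d) 0 (by omega) (by omega) (by omega)
              (by push_cast at hx ⊢; exact hx)
        rcases t0 with rfl | rfl | rfl
        · exact hneg _ (by push_cast; ring) t1
        · exact hneg _ (by push_cast; ring) t2
        · have := hmate (.inl ((0 : ℕ) : ZMod n))
          rw [mate_inl_zero, h0, hwalk, mate_inl_two_mul hd hn] at this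
          exact Sum.inl_ne_inr this
    obtain ⟨rfl, rfl⟩ := hc
    have hleft : ∀ p : ZMod n, π (.inl p) = .inl p := by
      intro p
      have := hwalk p.val
      simpa using this
    ext u
    change π u = u
    rcases u with p | q
    · exact hleft p
    rcases hq : π (.inr q) with p | q'
    · rw [← hleft p] at hq
      exact absurd (π.injective hq) Sum.inr_ne_inl
    have key : ∀ p, HaarAdj d (.inl p) (.inr q') ↔ HaarAdj d (.inl p) (.inr q) := by
      intro p
      rw [← hadj (.inl p) (.inr q), hq, hleft]
    -- Right points are determined by their neighbours: adjacency to both extreme neighbours `q` and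
    -- `q - (d - 1)` forces `q' = q`.
    obtain ⟨j, hj, h1⟩ := (key q).2 ⟨0, by omega, by simp⟩
    obtain ⟨j', hj', h2⟩ := (key (q - ((d - 1 : ℕ) : ZMod n))).2 ⟨d - 1, by omega, by simp⟩
    have h3 : ((d - 1 + j : ℕ) : ZMod n) = (j' : ℕ) := by
      have h : q + (j : ZMod n) = q - ((d - 1 : ℕ) : ZMod n) + j' := h1.symm.trans h2
      push_cast
      linear_combination h
    have hj0 : j = 0 := by
      have := zmod_natCast_eq_cases h3 (by omega) (by omega)
      omega
    rw [h1, hj0]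
    simp
  · exfalso
    -- If the sides were exchanged, `0` and `d` would both go to the only loopless right point `3d`.
    have hright : ∀ m : ℕ, ∃ q, π (.inl (m : ZMod n)) = .inr q := by
      intro m
      induction m with
      | zero => exact ⟨c, h0⟩
      | succ m ih =>
        obtain ⟨q, hq⟩ := ih
        have h := hstep m
        rw [hq] at h
        rcases e : π (.inl ((m : ZMod n) + 1)) with p | q'
        · rw [e] at h
          exact absurd h (NearTwin.not_inr_inl hd hn1)
        · exact ⟨q', by rw [Nat.cast_succ, e]⟩
    have hval : ∀ a : ℕ, mate d (π (.inl (a : ZMod n))) ≠ π (.inl (a : ZMod n)) →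
        π (.inl (a : ZMod n)) = .inr ((3 * d : ℕ) : ZMod n) := by
      intro a ha
      obtain ⟨q, hq⟩ := hright a
      rw [hq] at ha ⊢
      simpa using eq_of_mate_ne ha
    have h := Sum.inl.inj (π.injective ((hval _ b0).trans (hval _ b1).symm))
    exact natCast_ne_of_lt (by omega) (by omega) (by omega) h

/-! ### The mated Haar graph: absence of proper subsets to consider -/

theorem mate_add_one (hd : 3 ≤ d) (hn : 4 * d < n) {p : ZMod n}
    (h : mate d (.inl p) ≠ .inl p) : mate d (.inl (p + 1)) = .inl (p + 1) := by
  by_contra h'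
  have h1 : p = (0 : ℕ) ∨ p = d ∨ p = (2 * d : ℕ) := by simpa using eq_of_mate_ne h
  have h2 : p + 1 = (0 : ℕ) ∨ p + 1 = d ∨ p + 1 = (2 * d : ℕ) := by simpa using eq_of_mate_ne h'
  have key : ∀ a b : ℕ, a = 0 ∨ a = d ∨ a = 2 * d → b = 0 ∨ b = d ∨ b = 2 * d → p = a →
      p + 1 = b → False := by
    rintro a b ha hb rfl h
    exact natCast_ne_of_lt (n := n) (a := a + 1) (b := b) (by omega) (by omega) (by omega)
      (by rw [← h]; push_cast; ring)
  rcases h1 with h1 | h1 | h1 <;> rcases h2 with h2 | h2 | h2 <;>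
    exact key _ _ (by omega) (by omega) h1 h2

theorem mate_inr_add_one (hd : 3 ≤ d) (hn : 4 * d < n) {q : ZMod n}
    (h : mate d (.inr q) ≠ .inr q) : mate d (.inr (q + 1)) = .inr (q + 1) := by
  by_contra h'
  have h1 : q = (3 * d : ℕ) := by simpa using eq_of_mate_ne h
  have h2 : q + 1 = (3 * d : ℕ) := by simpa using eq_of_mate_ne h'
  subst h1
  rw [add_eq_left] at h2
  have : Fact (1 < n) := ⟨by omega⟩
  exact one_ne_zero h2

/-- An edge of the Haar graph at a point `u` with a mate lies on a `4`-cycle whose vertex opposite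
to `u` is its own mate. -/
theorem exists_square (hd : 3 ≤ d) (hn : 4 * d < n) {u v : ZMod n ⊕ ZMod n}
    (hu : mate d u ≠ u) (h : HaarAdj d u v) :
    ∃ w v', mate d w = w ∧ v ≠ v' ∧ HaarAdj d u v' ∧ HaarAdj d v' w ∧ HaarAdj d w v := by
  have : Fact (1 < n) := ⟨by omega⟩
  have hprev : ∀ {p : ZMod n}, mate d (.inl p) ≠ .inl p → mate d (.inl (p - 1)) = .inl (p - 1) :=
    fun {p} hp => by
      by_contra hc
      exact hp (by simpa using mate_add_one hd hn hc)
  have hprev' : ∀ {p : ZMod n}, mate d (.inr p) ≠ .inr p → mate d (.inr (p - 1)) = .inr (p - 1) :=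
    fun {p} hp => by
      by_contra hc
      exact hp (by simpa using mate_inr_add_one hd hn hc)
  -- The opposite vertex `w` is a cyclic neighbour of `u`, looped because loopless points on one
  -- side are never consecutive. Since `d ≥ 3`, `u` and `w` have at least two common neighbours; the
  -- direction is chosen so that `v` is one.
  rcases u with p | q <;> rcases v with p' | q'
  · exact h.elim
  · obtain ⟨j, hj, rfl⟩ := h
    obtain rfl | rfl | ⟨j, rfl⟩ : j = 0 ∨ j = 1 ∨ ∃ i, j = i + 2 := by
      rcases j with - | - | j
      · exact .inl rfl
      · exact .inr (.inl rfl)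
      · exact .inr (.inr ⟨j, rfl⟩)
    · exact ⟨.inl (p - 1), .inr (p + 1), hprev hu, by simp, ⟨1, by omega, by simp⟩,
        ⟨2, by omega, by push_cast; ring⟩, ⟨1, by omega, by simp⟩⟩
    · refine ⟨.inl (p + 1), .inr (p + 1 + 1), mate_add_one hd hn hu, by simp,
        ⟨2, by omega, by push_cast; ring⟩, ⟨1, by omega, by push_cast; ring⟩,
        ⟨0, by omega, by push_cast; ring⟩⟩
    · refine ⟨.inl (p + 1), .inr (p + (j : ZMod n) + 1), mate_add_one hd hn hu, ?_,
        ⟨j + 1, by omega, by push_cast; ring⟩, ⟨j, by omega, by ring⟩,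
        ⟨j + 1, by omega, by push_cast; ring⟩⟩
      intro hc
      have hc := Sum.inr.inj hc
      push_cast at hc
      exact one_ne_zero (α := ZMod n) (by linear_combination hc)
  · obtain ⟨j, hj, rfl⟩ := h
    obtain rfl | rfl | ⟨j, rfl⟩ : j = 0 ∨ j = 1 ∨ ∃ i, j = i + 2 := by
      rcases j with - | - | j
      · exact .inl rfl
      · exact .inr (.inl rfl)
      · exact .inr (.inr ⟨j, rfl⟩)
    · simp only [Nat.cast_zero, add_zero] at *
      exact ⟨.inr (p' + 1), .inl (p' - 1), mate_inr_add_one hd hn hu, by simp [sub_eq_add_neg],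
        ⟨1, by omega, by push_cast; ring⟩,
        ⟨2, by omega, by push_cast; ring⟩, ⟨1, by omega, by push_cast; ring⟩⟩
    · simp only [Nat.cast_one] at *
      refine ⟨.inr (p' + 1 - 1), .inl (p' - 1), hprev' hu, by simp [sub_eq_add_neg],
        ⟨2, by omega, by push_cast; ring⟩, ⟨1, by omega, by push_cast; ring⟩,
        ⟨0, by omega, by push_cast; ring⟩⟩
    · refine ⟨.inr (p' + (j + 2 : ℕ) - 1), .inl (p' + 1), hprev' hu, by simp,
        ⟨j + 1, by omega, by push_cast; ring⟩, ⟨j, by omega, by push_cast; ring⟩,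
        ⟨j + 1, by omega, by push_cast; ring⟩⟩
  · exact h.elim

/-- A looped point of `S` brings in all its Haar neighbours. A loopless one misses at most one, and
that one is reached around a 4-cycle through looped points. Connectedness of the Haar graph
finishes. -/
theorem eq_univ_of_matedHaar_private (hd : 3 ≤ d) (hn : 4 * d < n) (S : Set (ZMod n ⊕ ZMod n))
    (hne : S.Nonempty)
    (hpriv : ∀ x ∈ S, ∀ y y', matedHaar d x y → matedHaar d x y' → (y = x ∨ y ∉ S) →
      (y' = x ∨ y' ∉ S) → y = y') : S = univ := by
  have : NeZero n := ⟨by omega⟩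
  have hlow : ∀ {u v}, u ∈ S → mate d u = u → HaarAdj d u v → v ∈ S := by
    intro u v hu hm h
    by_contra hv
    have := hpriv u hu u v (.inr hm.symm) (.inl h) (.inl rfl) (.inr hv)
    exact hv (this ▸ hu)
  have hclosed : ∀ {u v}, u ∈ S → HaarAdj d u v → v ∈ S := by
    intro u v hu h
    by_cases hm : mate d u = u
    · exact hlow hu hm h
    by_contra hv
    obtain ⟨w, v', hw, hvv, h1, h2, h3⟩ := exists_square hd hn hm h
    have hv' : v' ∈ S := by
      by_contra hv'
      exact hvv (hpriv u hu v v' (.inl h) (.inl h1) (.inr hv) (.inr hv'))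
    have hm' : mate d v' = v' := by
      by_contra hm'
      exact not_haarAdj_of_mate_ne hn hm hm' h1
    exact hv (hlow (hlow hv' hm' h2) hw h3)
  obtain ⟨p, hp⟩ : ∃ p, .inl p ∈ S := by
    obtain ⟨p | q, h⟩ := hne
    · exact ⟨p, h⟩
    · exact ⟨q, hclosed h ⟨0, by omega, by simp⟩⟩
  have hwalk : ∀ m : ℕ, .inl (p + m) ∈ S := by
    intro m
    induction m with
    | zero => simpa using hp
    | succ m ih =>
      have h1 : .inr (p + m + 1) ∈ S := hclosed ih ⟨1, by omega, by push_cast; ring⟩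
      have h2 : .inl (p + m + 1) ∈ S := hclosed h1 ⟨0, by omega, by push_cast; ring⟩
      simpa [add_assoc] using h2
  have hleft : ∀ x : ZMod n, .inl x ∈ S := fun x => by
    simpa using hwalk (x - p).val
  refine eq_univ_of_forall fun u => ?_
  rcases u with x | x
  · exact hleft x
  · exact hclosed (hleft x) ⟨0, by omega, by simp⟩

end Hypergraph

theorem theorem2 (k : ℕ) (hk : 3 ≤ k) :
    ∃ (V : ℕ → Type) (G : (n : ℕ) → Hypergraph (V n)),
      (∀ m n : ℕ, m ≠ n → ¬ (G m).IsIsomorphic (G n)) ∧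
      ∀ n : ℕ,
        (G n).vertexSet.Finite ∧
        (G n).IsUniform k ∧
        (G n).IsMinimalAsymmetric ∧
        (G n).HasMaxDegree 2 ∧
        (G n).HasMaxCodegree 1 := by
  -- For `k = 3` one would have `d = 2`, where the Haar graph is a single long cycle without
  -- 4-cycles; hence the separate construction.
  obtain rfl | hk := hk.eq_or_lt
  · refine Hypergraph.exists_family_of_links (by omega) (fun n => Fin (n + 5 + 6 + 1)) ?_
      (fun n => Hypergraph.chordedPath (n + 5 + 6)) (fun n => Hypergraph.chordedPath_symm)
      (fun n => Hypergraph.ncard_chordedPath (by omega))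
      (fun n => ⟨⟨0, by omega⟩, ⟨1, by omega⟩, by simp, .inl (.inl rfl)⟩)
      (fun n => Hypergraph.chordedPath_rigid (by omega))
      (fun n => Hypergraph.exists_involution_chordedPath (by omega))
    intro m n h
    simpa using h
  · obtain ⟨d, rfl⟩ : ∃ d, k = d + 1 := ⟨k - 1, by omega⟩
    have hd : 3 ≤ d := by omega
    have (n : ℕ) : NeZero (4 * d + 1 + n) := ⟨by omega⟩
    refine Hypergraph.exists_family_of_links (by omega)
      (fun n => ZMod (4 * d + 1 + n) ⊕ ZMod (4 * d + 1 + n)) ?_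
      (fun n => Hypergraph.matedHaar d)
      (fun n => Hypergraph.matedHaar_symm (by omega) (by omega))
      (fun n => Hypergraph.ncard_matedHaar (by omega) (by omega))
      (fun n => ⟨.inl 0, .inr 0, by simp, .inl ⟨0, by omega, by simp⟩⟩)
      (fun n => Hypergraph.matedHaar_rigid (by omega) (by omega))
      (fun n S hne huniv hpriv =>
        absurd (Hypergraph.eq_univ_of_matedHaar_private hd (by omega) S hne hpriv) huniv)
    intro m n h
    simp only [Nat.card_sum, Nat.card_zmod] at h
    omega
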